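/- Let $L_1,L_2>0$, let $\mathbb T^2=(\mathbb R/L_1\mathbb Z)\times(\mathbb R/L_2\mathbb Z)$, and consider the two-dimensional Kuramoto–Sivashinsky system (2DKS) for $\mathbf u=(u,v):\mathbb T^2\times[0,\infty)\to\mathbb R^2$, $$u_t+uu_x+vv_x=-\Delta^2u-\Delta u,\qquad v_t+uu_y+vv_y=-\Delta^2v-\Delta v ,$$ supplemented, for curl-free initial data, by the constraint $u_y=v_x$. Let $J$ be an interval of the form $[0,T)$ or $[0,T]$ with $0<T<\infty$. A *mild solution* on $J$ with initial data $\mathbf u_0\in L^2(\mathbb T^2;\mathbb R^2)$ is a function $\mathbf u\in C(J;L^2(\mathbb T^2;\mathbb R^2))$ such that for all $t\in J$ $$\mathbf u(t)=e^{-t(\Delta^2+\Delta)}\mathbf u_0-\int_0^t e^{-(t-s)(\Delta^2+\Delta)}\,\nabla\Big(\frac{|\mathbf u(s)|^2}{2}\Big)\,ds ,$$ where the operators are Fourier multipliers, $\Delta^2+\Delta$ having the symbol $|\tilde{\mathbf k}|^4-|\tilde{\mathbf k}|^2$ with $\tilde{\mathbf k}=2\pi(k_1/L_1,k_2/L_2)$,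 $\mathbf k\in\mathbb Z^2$, and the identity is understood between Fourier coefficients. **Proposition.** Let $0<T<\infty$ and let $\mathbf u$ be a mild solution of 2DKS with initial data $\mathbf u_0\in L^2(\mathbb T^2;\mathbb R^2)$ on $J=[0,T)$ or $J=[0,T]$. If $$\limsup_{t\to T^-}\|\mathbf u(t)\|_{L^2(\mathbb T^2)}<\infty ,$$ then there are $T'>T$ and a mild solution $\mathbf u'$ with initial data $\mathbf u_0$ on $[0,T']$ that coincides with $\mathbf u$ on $J$ and is a classical solution on $(0,T')$: for $0<t<T'$ it is represented by a function that has one time derivative and all spatial derivatives up to order four, all jointly continuous on $(0,T')\times\mathbb T^2$, and that satisfies the two evolution equations at every point. If moreover $\mathbf u_0$ is curl free in the sense of distributions, then $u_y=v_x$ holds at every point of $(0,T')\times\mathbb T^2$. -/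

import Mathlib

open MeasureTheory

namespace KS2D

noncomputable section

/-- Points of the Euclidean plane; also the values of the velocity field `𝐮 = (u, v)`,
with `u` the component `0` and `v` the component `1`. -/
abbrev Plane : Type := EuclideanSpace ℝ (Fin 2)

/-- The flat torus of periods `L₁`, `L₂`. -/
abbrev Torus (L₁ L₂ : ℝ) : Type := AddCircle L₁ × AddCircle L₂

/-- The Hilbert space `L²(𝕋²; ℝ²)` of square integrable vector fields. -/
abbrev L2Field (L₁ L₂ : ℝ) [Fact (0 < L₁)] [Fact (0 < L₂)] : Type :=
  Lp Plane 2 (volume : Measure (Torus L₁ L₂))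

/-- The frequency `(2π k₁ / L₁, 2π k₂ / L₂)`; the Fourier symbol of `∂_j` is
`i` times its `j`-th component. -/
def freq (L₁ L₂ : ℝ) (k : ℤ × ℤ) : Fin 2 → ℝ :=
  ![2 * Real.pi * k.1 / L₁, 2 * Real.pi * k.2 / L₂]

/-- The Fourier symbol `σ(k) = |κ|⁴ - |κ|²`, `κ = freq k`, of `Δ² + Δ`. -/
def symb (L₁ L₂ : ℝ) (k : ℤ × ℤ) : ℝ :=
  (freq L₁ L₂ k 0 ^ 2 + freq L₁ L₂ k 1 ^ 2) ^ 2 - (freq L₁ L₂ k 0 ^ 2 + freq L₁ L₂ k 1 ^ 2)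

/-- The Fourier coefficient
`(L₁ L₂)⁻¹ ∫ f(x, y) exp(-2πi (k₁ x / L₁ + k₂ y / L₂)) dx dy` of a function on the torus. -/
def coeff {L₁ L₂ : ℝ} [Fact (0 < L₁)] [Fact (0 < L₂)] (f : Torus L₁ L₂ → ℝ) (k : ℤ × ℤ) : ℂ :=
  ((L₁ * L₂ : ℝ) : ℂ)⁻¹ *
    ∫ z : Torus L₁ L₂, fourier (-k.1) z.1 * fourier (-k.2) z.2 * (f z : ℂ)

/-- The `k`-th Fourier coefficient of `∫₀ᵗ e^{-(t-s)(Δ² + Δ)} ∂_j h(s) ds`. -/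
def duhamelCoeff {L₁ L₂ : ℝ} [Fact (0 < L₁)] [Fact (0 < L₂)] (h : ℝ → Torus L₁ L₂ → ℝ)
    (j : Fin 2) (k : ℤ × ℤ) (t : ℝ) : ℂ :=
  Complex.I * (freq L₁ L₂ k j : ℂ) *
    ∫ s in (0 : ℝ)..t, (Real.exp (-(t - s) * symb L₁ L₂ k) : ℂ) * coeff (h s) k

/-- `u` is a mild solution with initial datum `u₀` on the time interval `J` (of the form
`[0, T)` or `[0, T]`): `u ∈ C(J; L²)` and, for all `t ∈ J`,
`u(t) = e^{-t(Δ² + Δ)} u₀ - ∫₀ᵗ e^{-(t-s)(Δ² + Δ)} ∇(|u(s)|² / 2) ds`.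
The gradient of the `L¹` function `|u(s)|² / 2` is in general only a distribution; the operators
are Fourier multipliers, and the identity is one between Fourier coefficients. -/
structure IsMildSolution {L₁ L₂ : ℝ} [Fact (0 < L₁)] [Fact (0 < L₂)]
    (u₀ : L2Field L₁ L₂) (J : Set ℝ) (u : ℝ → L2Field L₁ L₂) : Prop where
  continuousOn : ContinuousOn u J
  duhamel : ∀ t ∈ J, ∀ (j : Fin 2) (k : ℤ × ℤ),
    coeff (fun z => u t z j) k =
      (Real.exp (-t * symb L₁ L₂ k) : ℂ) * coeff (fun z => u₀ z j) k
        - duhamelCoeff (fun s z => ‖u s z‖ ^ 2 / 2) j k t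

/-- The periodic function on the plane given by a function on the torus. -/
def lift {L₁ L₂ : ℝ} (w : Torus L₁ L₂ → Plane) : Plane → Plane :=
  fun p => w ((p 0 : AddCircle L₁), (p 1 : AddCircle L₂))

/-- The partial derivative `∂_j f`. -/
def pderiv (j : Fin 2) (f : Plane → ℝ) (p : Plane) : ℝ :=
  fderiv ℝ f p (EuclideanSpace.single j 1)

/-- `w` is a classical solution, for times in `(a, b)`, of
`u_t + u u_x + v v_x = -Δ²u - Δu`, `v_t + u u_y + v v_y = -Δ²v - Δv`:
it is `C¹` in time and `C⁴` in space, with all these derivatives jointly continuous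
in time and space, and the equations hold at every point. -/
structure IsClassicalSolution {L₁ L₂ : ℝ} (a b : ℝ) (w : ℝ → Torus L₁ L₂ → Plane) : Prop where
  contDiff_space : ∀ t ∈ Set.Ioo a b, ContDiff ℝ 4 (lift (w t))
  continuous_space : ∀ i : ℕ, i ≤ 4 →
    ContinuousOn (fun q : ℝ × Plane => iteratedFDeriv ℝ i (lift (w q.1)) q.2)
      (Set.Ioo a b ×ˢ Set.univ)
  differentiable_time : ∀ t ∈ Set.Ioo a b, ∀ p : Plane,
    DifferentiableAt ℝ (fun s => lift (w s) p) t
  continuous_time :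
    ContinuousOn (fun q : ℝ × Plane => deriv (fun s => lift (w s) q.2) q.1)
      (Set.Ioo a b ×ˢ Set.univ)
  equation : ∀ t ∈ Set.Ioo a b, ∀ (p : Plane) (j : Fin 2),
    deriv (fun s => lift (w s) p j) t
        + (lift (w t) p 0 * pderiv j (fun q => lift (w t) q 0) p
          + lift (w t) p 1 * pderiv j (fun q => lift (w t) q 1) p)
      = - Laplacian.laplacian (Laplacian.laplacian (fun q => lift (w t) q j)) p
        - Laplacian.laplacian (fun q => lift (w t) q j) p

/-- A square integrable field `(u, v)` is curl free, `u_y = v_x`, in the sense of distributions: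
the Fourier coefficients of the two derivatives agree. -/
def IsCurlFree {L₁ L₂ : ℝ} [Fact (0 < L₁)] [Fact (0 < L₂)] (f : L2Field L₁ L₂) : Prop :=
  ∀ k : ℤ × ℤ, Complex.I * (freq L₁ L₂ k 1 : ℂ) * coeff (fun z => f z 0) k =
    Complex.I * (freq L₁ L₂ k 0 : ℂ) * coeff (fun z => f z 1) k

end

end KS2D

/-! Everything is read off the Fourier coefficients. Write `⟨k⟩` for `bracket` and `q(s, k)` for the
coefficients of `|u(s)|² / 2`. The Duhamel formula expresses the coefficients of `u(t)` through
those of `u₀` and `q`, and `q` is bounded, uniformly in `k`, by the squared `L²` norm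
(`norm_quad_le`).

The point is that an `L²` bound is already subcritical. Since `σ(k) ≥ ⟨k⟩⁴/4 - 1`, integrating the
kernel in time gains `⟨k⟩⁻⁴`, the gradient costs `⟨k⟩`, and what remains, `⟨k⟩⁻³`, is summable over
a two-dimensional lattice. Hence a mild solution bounded in `L²` has absolutely summable
coefficients at every positive time (`norm_duh_le`, `norm_mildCoeff_le`, `summable_bracket_pow`).

Continuation: the limsup hypothesis and continuity bound `u` on `[0, T)`, so the Duhamel formula
still makes sense at `T` and yields a datum with absolutely summable coefficients. A contraction
argument solves the equation from this datum for a short time (`exists_local_solution`), and the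
restart identity `mildCoeff_add` shows that the glued function satisfies one Duhamel formula from
time `0` (`exists_extension`). Continuity across `T`, and agreement with `u(T)` when `T ∈ J`, follow
from that formula, so no uniqueness theorem is needed.

Regularity: decay of order `n ≥ 3` survives convolution (`norm_conv_le`), and each passage through
the Duhamel formula, restarted at a positive time, gains three more powers. Iterating gives
arbitrary polynomial decay away from time zero (`IsMildSolution.exists_decay`); the Fourier series
may then be differentiated termwise, and the equation for the coefficients becomes the equation in
physical space. The forcing is a gradient, so the curl condition is preserved coefficient by
coefficient. -/

namespace KS2D

noncomputable section

/-! ### Characters of the torus and completeness of the Fourier system. -/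

section Exponentials

variable {L₁ L₂ : ℝ}

/-- The character `(x, y) ↦ exp(2πi (k₁ x / L₁ + k₂ y / L₂))` of the torus. -/
def expo (k : ℤ × ℤ) : C(Torus L₁ L₂, ℂ) where
  toFun z := fourier k.1 z.1 * fourier k.2 z.2

theorem expo_apply (k : ℤ × ℤ) (z : Torus L₁ L₂) :
    expo k z = fourier k.1 z.1 * fourier k.2 z.2 := rfl

theorem expo_zero : (expo 0 : C(Torus L₁ L₂, ℂ)) = 1 := by
  ext z; simp [expo_apply]

theorem expo_add (k l : ℤ × ℤ) (z : Torus L₁ L₂) : expo (k + l) z = expo k z * expo l z := by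
  simp only [expo_apply, Prod.fst_add, Prod.snd_add, fourier_add]; ring

theorem expo_neg (k : ℤ × ℤ) (z : Torus L₁ L₂) :
    expo (-k) z = (starRingEnd ℂ) (expo k z) := by
  simp only [expo_apply, Prod.fst_neg, Prod.snd_neg, fourier_neg, map_mul]

@[simp] theorem norm_expo_apply (k : ℤ × ℤ) (z : Torus L₁ L₂) : ‖expo k z‖ = 1 := by
  rw [expo_apply, norm_mul, fourier_apply, fourier_apply, Circle.norm_coe, Circle.norm_coe, one_mul]

theorem norm_expo_le (k : ℤ × ℤ) [Fact (0 < L₁)] [Fact (0 < L₂)] :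
    ‖(expo k : C(Torus L₁ L₂, ℂ))‖ ≤ 1 :=
  (ContinuousMap.norm_le _ zero_le_one).2 fun z => (norm_expo_apply k z).le

/-- The star algebra generated by the characters. -/
def expoSubalgebra (L₁ L₂ : ℝ) : StarSubalgebra ℂ C(Torus L₁ L₂, ℂ) where
  toSubalgebra := Algebra.adjoin ℂ (Set.range expo)
  star_mem' := by
    change Algebra.adjoin ℂ (Set.range expo) ≤ star (Algebra.adjoin ℂ (Set.range expo))
    refine Algebra.adjoin_le ?_
    rintro _ ⟨n, rfl⟩
    refine Algebra.subset_adjoin ⟨-n, ?_⟩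
    ext1 x
    simp only [expo_neg, starRingEnd_apply, ContinuousMap.star_apply]

/-- A product of characters is a character, so generating an algebra adds nothing to the linear
span. -/
theorem expoSubalgebra_coe (L₁ L₂ : ℝ) :
    (expoSubalgebra L₁ L₂).toSubalgebra.toSubmodule = Submodule.span ℂ (Set.range expo) := by
  apply Algebra.adjoin_eq_span_of_subset
  refine .trans (fun x ↦ Submonoid.closure_induction (fun _ ↦ id) ⟨0, expo_zero⟩ ?_)
    Submodule.subset_span
  rintro _ _ _ _ ⟨m, rfl⟩ ⟨n, rfl⟩
  exact ⟨m + n, by ext z; exact expo_add m n z⟩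

variable [Fact (0 < L₁)] [Fact (0 < L₂)]

theorem integral_fourier_addCircle {T : ℝ} [hT : Fact (0 < T)] (n : ℤ) :
    ∫ x : AddCircle T, fourier n x = if n = 0 then (T : ℂ) else 0 := by
  have h := congrFun (fourierCoeff_fourier (T := T) n) 0
  simp only [fourierCoeff, neg_zero, fourier_zero, one_smul] at h
  rw [AddCircle.integral_haarAddCircle] at h
  -- `fourierCoeff` uses the Haar measure of mass one, `volume` has mass `T`; the factor is restored
  -- here.
  have hT' : (T : ℂ) ≠ 0 := by exact_mod_cast hT.out.ne'
  have h2 : ∫ x : AddCircle T, fourier n x = T • (Pi.single n (1 : ℂ) : ℤ → ℂ) 0 := by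
    rw [← h, smul_smul, mul_inv_cancel₀ hT.out.ne', one_smul]
  rw [h2]
  by_cases hn : n = 0
  · subst hn; simp
  · simp [hn, Ne.symm hn]

theorem integral_expo (k : ℤ × ℤ) :
    ∫ z : Torus L₁ L₂, expo k z = if k = 0 then ((L₁ * L₂ : ℝ) : ℂ) else 0 := by
  simp only [expo_apply]
  rw [Measure.volume_eq_prod, integral_prod_mul (fun x : AddCircle L₁ => fourier k.1 x)
    (fun y : AddCircle L₂ => fourier k.2 y), integral_fourier_addCircle,
    integral_fourier_addCircle]
  rcases k with ⟨a, b⟩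
  by_cases ha : a = 0 <;> by_cases hb : b = 0 <;> simp [ha, hb]

theorem expoSubalgebra_separatesPoints : (expoSubalgebra L₁ L₂).SeparatesPoints := by
  intro x y hxy
  have key : ∀ k : ℤ × ℤ, (expo k x : ℂ) ≠ expo k y →
      ∃ f ∈ (fun f : C(Torus L₁ L₂, ℂ) => (f : Torus L₁ L₂ → ℂ)) ''
        (expoSubalgebra L₁ L₂ : Set C(Torus L₁ L₂, ℂ)), f x ≠ f y := fun k hk =>
    ⟨_, ⟨expo k, Algebra.subset_adjoin ⟨k, rfl⟩, rfl⟩, hk⟩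
  by_cases h1 : x.1 = y.1
  · have h2 : x.2 ≠ y.2 := fun h2 => hxy (Prod.ext h1 h2)
    refine key (0, 1) fun h => h2 ?_
    simp only [expo_apply, fourier_zero, fourier_one, one_mul] at h
    exact AddCircle.injective_toCircle (Fact.out : 0 < L₂).ne' (Subtype.coe_injective h)
  · refine key (1, 0) fun h => h1 ?_
    simp only [expo_apply, fourier_zero, fourier_one, mul_one] at h
    exact AddCircle.injective_toCircle (Fact.out : 0 < L₁).ne' (Subtype.coe_injective h)

/-- Stone–Weierstrass. -/
theorem span_expo_closure_eq_top :
    (Submodule.span ℂ (Set.range (expo (L₁ := L₁) (L₂ := L₂)))).topologicalClosure = ⊤ := by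
  rw [← expoSubalgebra_coe]
  exact congr_arg (Subalgebra.toSubmodule <| StarSubalgebra.toSubalgebra ·)
    (ContinuousMap.starSubalgebra_topologicalClosure_eq_top_of_separatesPoints _
      expoSubalgebra_separatesPoints)

theorem span_toLp_expo_closure_eq_top :
    (Submodule.span ℂ (Set.range fun k : ℤ × ℤ =>
      ContinuousMap.toLp 2 (volume : Measure (Torus L₁ L₂)) ℂ (expo k))).topologicalClosure
      = ⊤ := by
  simpa only [Submodule.map_span, ContinuousLinearMap.coe_coe, ← Set.range_comp,
    Function.comp_def] using
    (ContinuousMap.toLp_denseRange ℂ (volume : Measure (Torus L₁ L₂)) ℂ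
      (by norm_num : (2 : ENNReal) ≠ ⊤)).topologicalClosure_map_submodule span_expo_closure_eq_top

theorem coeff_eq (f : Torus L₁ L₂ → ℝ) (k : ℤ × ℤ) :
    coeff f k = ((L₁ * L₂ : ℝ) : ℂ)⁻¹ * ∫ z : Torus L₁ L₂, expo (-k) z * (f z : ℂ) := rfl

theorem area_pos : 0 < L₁ * L₂ :=
  mul_pos (Fact.out : 0 < L₁) (Fact.out : 0 < L₂)

theorem area_ne_zero : ((L₁ * L₂ : ℝ) : ℂ) ≠ 0 := by
  exact_mod_cast (area_pos (L₁ := L₁) (L₂ := L₂)).ne'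

theorem coeff_congr_ae {f g : Torus L₁ L₂ → ℝ} (h : f =ᵐ[volume] g) (k : ℤ × ℤ) :
    coeff f k = coeff g k := by
  rw [coeff_eq, coeff_eq]
  congr 1
  exact integral_congr_ae (h.mono fun z hz => by simp only [hz])

theorem integrable_expo_mul {f : Torus L₁ L₂ → ℝ} (hf : Integrable f) (k : ℤ × ℤ) :
    Integrable fun z : Torus L₁ L₂ => expo k z * (f z : ℂ) := by
  refine hf.ofReal.bdd_mul (c := 1) (expo k).continuous.aestronglyMeasurable ?_
  exact .of_forall fun z => (norm_expo_apply k z).le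

theorem coeff_sub {f g : Torus L₁ L₂ → ℝ} (hf : Integrable f) (hg : Integrable g) (k : ℤ × ℤ) :
    coeff (fun z => f z - g z) k = coeff f k - coeff g k := by
  rw [coeff_eq, coeff_eq, coeff_eq, ← mul_sub,
    ← integral_sub (integrable_expo_mul hf _) (integrable_expo_mul hg _)]
  congr 2; ext z; push_cast; ring

theorem norm_coeff_le (f : Torus L₁ L₂ → ℝ) (k : ℤ × ℤ) :
    ‖coeff f k‖ ≤ (L₁ * L₂)⁻¹ * ∫ z, |f z| := by
  rw [coeff_eq, norm_mul, norm_inv, Complex.norm_real, Real.norm_of_nonneg area_pos.le]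
  gcongr
  · exact inv_nonneg.2 area_pos.le
  refine (norm_integral_le_integral_norm _).trans_eq ?_
  congr 1; ext z; simp

theorem coeff_neg_index (f : Torus L₁ L₂ → ℝ) (k : ℤ × ℤ) :
    coeff f (-k) = (starRingEnd ℂ) (coeff f k) := by
  rw [coeff_eq, coeff_eq, map_mul, map_inv₀, Complex.conj_ofReal, ← integral_conj]
  congr 2; ext z
  rw [map_mul, Complex.conj_ofReal, ← expo_neg]

/-- The coefficients are, up to a nonzero factor, inner products with characters, whose span is
dense in `L²`; a function orthogonal to all of them vanishes. -/
theorem ae_eq_zero_of_coeff_eq_zero {f : Torus L₁ L₂ → ℝ} (hf : MemLp f 2)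
    (h : ∀ k, coeff f k = 0) : f =ᵐ[volume] 0 := by
  have hF : MemLp (fun z => (f z : ℂ)) 2 (volume : Measure (Torus L₁ L₂)) := hf.ofReal
  have hz : hF.toLp = 0 := by
    rw [← Submodule.mem_bot (R := ℂ), ← Submodule.top_orthogonal_eq_bot,
      ← span_toLp_expo_closure_eq_top, Submodule.orthogonal_closure]
    rw [Submodule.mem_orthogonal]
    intro v hv
    induction hv using Submodule.span_induction with
    | zero => simp
    | add x y _ _ hx hy => rw [inner_add_left, hx, hy, add_zero]
    | smul a x _ hx => rw [inner_smul_left, hx, mul_zero]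
    | mem x hx =>
      obtain ⟨k, rfl⟩ := hx
      rw [L2.inner_def]
      have hk := h k
      rw [coeff_eq, mul_eq_zero, or_iff_right (inv_ne_zero area_ne_zero)] at hk
      rw [← hk]
      refine integral_congr_ae ?_
      filter_upwards [hF.coeFn_toLp, ContinuousMap.coeFn_toLp (p := 2) (𝕜 := ℂ)
        (volume : Measure (Torus L₁ L₂)) (expo k)] with z h1 h2
      rw [h1, h2, expo_neg, RCLike.inner_apply, mul_comm]
  have h0 : hF.toLp =ᵐ[volume] 0 := by rw [hz]; exact Lp.coeFn_zero _ _ _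
  filter_upwards [hF.coeFn_toLp, h0] with z h1 h2
  rw [h1] at h2
  exact Complex.ofReal_eq_zero.1 h2

theorem ae_eq_of_coeff_eq {f g : Torus L₁ L₂ → ℝ} (hf : MemLp f 2) (hg : MemLp g 2)
    (h : ∀ k, coeff f k = coeff g k) : f =ᵐ[volume] g := by
  have := ae_eq_zero_of_coeff_eq_zero (hf.sub hg) fun k => by
    have := coeff_sub (hf.integrable one_le_two) (hg.integrable one_le_two) k
    rw [h k, sub_self] at this
    exact this
  filter_upwards [this] with z hz
  simpa [sub_eq_zero] using hz

end Exponentials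

/-! ### Frequency weights, coercivity of the symbol, and lattice sums. -/

section Bracket

/-- The Japanese bracket `(1 + |κ|²)^{1/2}` of the frequency `κ = freq k`. -/
def bracket (L₁ L₂ : ℝ) (k : ℤ × ℤ) : ℝ :=
  Real.sqrt (1 + freq L₁ L₂ k 0 ^ 2 + freq L₁ L₂ k 1 ^ 2)

variable {L₁ L₂ : ℝ}

theorem bracket_sq (k : ℤ × ℤ) :
    bracket L₁ L₂ k ^ 2 = 1 + freq L₁ L₂ k 0 ^ 2 + freq L₁ L₂ k 1 ^ 2 :=
  Real.sq_sqrt (by positivity)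

theorem one_le_bracket (k : ℤ × ℤ) : 1 ≤ bracket L₁ L₂ k :=
  Real.one_le_sqrt.2 (by nlinarith [sq_nonneg (freq L₁ L₂ k 0), sq_nonneg (freq L₁ L₂ k 1)])

theorem bracket_pos (k : ℤ × ℤ) : 0 < bracket L₁ L₂ k := one_pos.trans_le (one_le_bracket k)

theorem abs_freq_le (k : ℤ × ℤ) (j : Fin 2) : |freq L₁ L₂ k j| ≤ bracket L₁ L₂ k := by
  refine Real.abs_le_sqrt ?_
  fin_cases j <;> simp <;> nlinarith [sq_nonneg (freq L₁ L₂ k 0), sq_nonneg (freq L₁ L₂ k 1)]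

theorem freq_neg (k : ℤ × ℤ) (j : Fin 2) : freq L₁ L₂ (-k) j = -freq L₁ L₂ k j := by
  fin_cases j <;> simp [freq] <;> ring

theorem freq_add (k l : ℤ × ℤ) (j : Fin 2) :
    freq L₁ L₂ (k + l) j = freq L₁ L₂ k j + freq L₁ L₂ l j := by
  fin_cases j <;> simp [freq] <;> ring

theorem symb_neg (k : ℤ × ℤ) : symb L₁ L₂ (-k) = symb L₁ L₂ k := by
  simp [symb, freq_neg]

/-- After squaring this is Cauchy–Schwarz for the frequency vectors, proved through Lagrange's
identity. -/
theorem bracket_add_le (k l : ℤ × ℤ) :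
    bracket L₁ L₂ (k + l) ≤ bracket L₁ L₂ k + bracket L₁ L₂ l := by
  refine le_of_sq_le_sq ?_ (add_nonneg (bracket_pos k).le (bracket_pos l).le)
  have h1 := bracket_sq (L₁ := L₁) (L₂ := L₂) k
  have h2 := bracket_sq (L₁ := L₁) (L₂ := L₂) l
  have h3 : freq L₁ L₂ k 0 * freq L₁ L₂ l 0 + freq L₁ L₂ k 1 * freq L₁ L₂ l 1
      ≤ bracket L₁ L₂ k * bracket L₁ L₂ l := by
    refine abs_le_of_sq_le_sq' ?_ (mul_pos (bracket_pos k) (bracket_pos l)).le |>.2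
    rw [mul_pow, h1, h2]
    nlinarith [sq_nonneg (freq L₁ L₂ k 0 * freq L₁ L₂ l 1 - freq L₁ L₂ k 1 * freq L₁ L₂ l 0),
      sq_nonneg (freq L₁ L₂ k 0), sq_nonneg (freq L₁ L₂ k 1), sq_nonneg (freq L₁ L₂ l 0),
      sq_nonneg (freq L₁ L₂ l 1)]
  rw [add_sq, h1, h2, bracket_sq, freq_add, freq_add]
  nlinarith

/-- The symbol of `Δ² + Δ` is coercive up to a constant. -/
theorem le_symb (k : ℤ × ℤ) : bracket L₁ L₂ k ^ 4 / 4 - 1 ≤ symb L₁ L₂ k := by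
  have h : bracket L₁ L₂ k ^ 4 = (1 + freq L₁ L₂ k 0 ^ 2 + freq L₁ L₂ k 1 ^ 2) ^ 2 := by
    rw [← bracket_sq]; ring
  rw [h, symb]
  -- With `x = |κ|²`, the difference of the two sides is exactly `3/4 * (x - 1)²`.
  nlinarith [sq_nonneg (freq L₁ L₂ k 0 ^ 2 + freq L₁ L₂ k 1 ^ 2 - 1)]

theorem abs_symb_le (k : ℤ × ℤ) : |symb L₁ L₂ k| ≤ bracket L₁ L₂ k ^ 4 := by
  have h : bracket L₁ L₂ k ^ 4 = (1 + freq L₁ L₂ k 0 ^ 2 + freq L₁ L₂ k 1 ^ 2) ^ 2 := by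
    rw [← bracket_sq]; ring
  rw [h, symb, abs_le]
  constructor <;>
  nlinarith [sq_nonneg (freq L₁ L₂ k 0), sq_nonneg (freq L₁ L₂ k 1)]

/-- Comparison with the lattice sum of `max(|k₁|, |k₂|)⁻³` known from Eisenstein series; the
exponent must exceed the dimension two. -/
theorem summable_bracket_pow [Fact (0 < L₁)] [Fact (0 < L₂)] {n : ℕ} (hn : 3 ≤ n) :
    Summable fun k : ℤ × ℤ => (bracket L₁ L₂ k ^ n)⁻¹ := by
  have h1 : (0 : ℝ) < L₁ := Fact.out
  have h2 : (0 : ℝ) < L₂ := Fact.out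
  have base : Summable fun k : ℤ × ℤ => (max |(k.1 : ℝ)| |(k.2 : ℝ)|) ^ (-(3 : ℝ)) := by
    have := EisensteinSeries.summable_one_div_norm_rpow (k := 3) (by norm_num)
    rw [← (finTwoArrowEquiv ℤ).symm.summable_iff] at this
    convert this using 2 with k
    simp [EisensteinSeries.norm_eq_max_natAbs]
  obtain ⟨c, hc, hc1, hc2⟩ : ∃ c : ℝ, 0 < c ∧ c ≤ 2 * Real.pi / L₁ ∧ c ≤ 2 * Real.pi / L₂ :=
    ⟨min (2 * Real.pi / L₁) (2 * Real.pi / L₂), by positivity, min_le_left _ _, min_le_right _ _⟩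
  -- The comparison fails at `k = 0`, where the real power of zero is zero by convention; a cofinite
  -- bound suffices.
  refine Summable.of_norm_bounded_eventually (base.mul_left (c ^ 3)⁻¹) ?_
  rw [Filter.eventually_cofinite]
  refine (Set.finite_singleton (0 : ℤ × ℤ)).subset fun k hk => ?_
  by_contra hk0
  apply hk
  have hm : 0 < max |(k.1 : ℝ)| |(k.2 : ℝ)| := by
    by_contra hm
    push Not at hm
    have e1 := (le_max_left _ _).trans hm
    have e2 := (le_max_right _ _).trans hm
    have e1 := abs_nonpos_iff.1 e1
    have e2 := abs_nonpos_iff.1 e2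
    exact hk0 (Prod.ext (by exact_mod_cast e1) (by exact_mod_cast e2))
  have hb : c * max |(k.1 : ℝ)| |(k.2 : ℝ)| ≤ bracket L₁ L₂ k := by
    rw [mul_max_of_nonneg _ _ hc.le]
    refine max_le ?_ ?_
    · refine le_trans ?_ (abs_freq_le k 0)
      have : freq L₁ L₂ k 0 = 2 * Real.pi / L₁ * k.1 := by simp [freq]; ring
      rw [this, abs_mul, abs_of_pos (show 0 < 2 * Real.pi / L₁ by positivity)]
      gcongr
    · refine le_trans ?_ (abs_freq_le k 1)
      have : freq L₁ L₂ k 1 = 2 * Real.pi / L₂ * k.2 := by simp [freq]; ring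
      rw [this, abs_mul, abs_of_pos (show 0 < 2 * Real.pi / L₂ by positivity)]
      gcongr
  rw [Real.norm_of_nonneg (inv_nonneg.2 (pow_nonneg (bracket_pos k).le _)), Real.rpow_neg hm.le,
    ← mul_inv]
  have h3 : (max |(k.1 : ℝ)| |(k.2 : ℝ)|) ^ (3 : ℝ) = (max |(k.1 : ℝ)| |(k.2 : ℝ)|) ^ 3 := by
    rw [← Real.rpow_natCast]; norm_num
  rw [h3, ← mul_pow]
  refine inv_anti₀ (by positivity) ?_
  calc _ ≤ bracket L₁ L₂ k ^ 3 := by gcongr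
    _ ≤ _ := pow_le_pow_right₀ (one_le_bracket k) hn

end Bracket

/-! ### Absolutely convergent Fourier series and convolution of coefficients. -/

section FourierSeries

variable {L₁ L₂ : ℝ} [Fact (0 < L₁)] [Fact (0 < L₂)]

/-- The sum of an absolutely convergent Fourier series, as a continuous function. -/
def fourierSeries (L₁ L₂ : ℝ) [Fact (0 < L₁)] [Fact (0 < L₂)] (b : ℤ × ℤ → ℂ) :
    C(Torus L₁ L₂, ℂ) := ∑' k, b k • expo k

theorem norm_smul_expo_le (c : ℂ) (k : ℤ × ℤ) :
    ‖c • (expo k : C(Torus L₁ L₂, ℂ))‖ ≤ ‖c‖ := by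
  rw [norm_smul]
  exact mul_le_of_le_one_right (norm_nonneg _) (norm_expo_le k)

theorem summable_smul_expo {b : ℤ × ℤ → ℂ} (hb : Summable b) :
    Summable fun k => b k • (expo k : C(Torus L₁ L₂, ℂ)) :=
  .of_norm_bounded hb.norm fun k => norm_smul_expo_le (b k) k

theorem summable_mul_expo {L₁ L₂ : ℝ} {b : ℤ × ℤ → ℂ} (hb : Summable b) (z : Torus L₁ L₂) :
    Summable fun k => b k * expo k z :=
  .of_norm_bounded hb.norm fun k => by simp

theorem fourierSeries_apply {b : ℤ × ℤ → ℂ} (hb : Summable b) (z : Torus L₁ L₂) :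
    fourierSeries L₁ L₂ b z = ∑' k, b k * expo k z := by
  rw [fourierSeries, ← ContinuousMap.tsum_apply (summable_smul_expo hb)]
  rfl

theorem norm_fourierSeries_le {b : ℤ × ℤ → ℂ} (hb : Summable b) :
    ‖fourierSeries L₁ L₂ b‖ ≤ ∑' k, ‖b k‖ :=
  tsum_of_norm_bounded hb.norm.hasSum fun k => norm_smul_expo_le (b k) k

theorem fourierSeries_sub {a b : ℤ × ℤ → ℂ} (ha : Summable a) (hb : Summable b) :
    fourierSeries L₁ L₂ (fun k => a k - b k) = fourierSeries L₁ L₂ a - fourierSeries L₁ L₂ b := by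
  rw [fourierSeries, fourierSeries, fourierSeries,
    ← (summable_smul_expo ha).tsum_sub (summable_smul_expo hb)]
  simp only [sub_smul]

theorem continuousOn_fourierSeries {X : Type*} [TopologicalSpace X] {b : X → ℤ × ℤ → ℂ}
    {s : Set X} {B : ℤ × ℤ → ℝ} (hc : ∀ k, ContinuousOn (fun x => b x k) s) (hB : Summable B)
    (hb : ∀ k, ∀ x ∈ s, ‖b x k‖ ≤ B k) :
    ContinuousOn (fun x => fourierSeries L₁ L₂ (b x)) s :=
  continuousOn_tsum (fun k => (hc k).smul continuousOn_const) hB fun k x hx =>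
    (norm_smul_expo_le _ _).trans (hb k x hx)

/-- The symmetry of the Fourier coefficients of real functions. -/
def IsHermitianSeq (b : ℤ × ℤ → ℂ) : Prop := ∀ k, b (-k) = (starRingEnd ℂ) (b k)

theorem conj_fourierSeries {b : ℤ × ℤ → ℂ} (hb : Summable b) (hs : IsHermitianSeq b)
    (z : Torus L₁ L₂) :
    (starRingEnd ℂ) (fourierSeries L₁ L₂ b z) = fourierSeries L₁ L₂ b z := by
  rw [fourierSeries_apply hb, Complex.conj_tsum, ← (Equiv.neg (ℤ × ℤ)).tsum_eq]
  congr 1; ext k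
  rw [Equiv.neg_apply, hs, expo_neg, map_mul, Complex.conj_conj, Complex.conj_conj]

theorem ofReal_re_fourierSeries {b : ℤ × ℤ → ℂ} (hb : Summable b) (hs : IsHermitianSeq b)
    (z : Torus L₁ L₂) :
    (((fourierSeries L₁ L₂ b z).re : ℝ) : ℂ) = fourierSeries L₁ L₂ b z :=
  Complex.conj_eq_iff_re.1 (conj_fourierSeries hb hs z)

/-- Orthogonality of characters; absolute summability permits the exchange of sum and integral. -/
theorem integral_expo_mul_fourierSeries {b : ℤ × ℤ → ℂ} (hb : Summable b) (k : ℤ × ℤ) :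
    ((L₁ * L₂ : ℝ) : ℂ)⁻¹ * ∫ z : Torus L₁ L₂, expo (-k) z * fourierSeries L₁ L₂ b z = b k := by
  have h1 : ∀ l, Integrable fun z : Torus L₁ L₂ => b l * expo (l - k) z := fun l =>
    ((expo (l - k)).continuous.const_mul (b l)).integrable_of_hasCompactSupport
      (HasCompactSupport.of_compactSpace _)
  have h2 := hasSum_integral_of_summable_integral_norm h1 (by
    simp only [norm_mul, norm_expo_apply, mul_one, integral_const, smul_eq_mul]
    exact hb.norm.mul_left _)
  have h3 : ∀ z : Torus L₁ L₂, expo (-k) z * fourierSeries L₁ L₂ b z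
      = ∑' l, b l * expo (l - k) z := fun z => by
    rw [fourierSeries_apply hb, ← tsum_mul_left]
    congr 1; ext l
    rw [sub_eq_add_neg, expo_add]; ring
  simp only [h3]
  rw [← h2.tsum_eq, tsum_eq_single k]
  · rw [integral_const_mul, integral_expo, if_pos (sub_self k), mul_comm, mul_assoc,
      mul_inv_cancel₀ area_ne_zero, mul_one]
  · intro l hl
    rw [integral_const_mul, integral_expo, if_neg (sub_ne_zero.2 hl), mul_zero]

theorem coeff_re_fourierSeries {b : ℤ × ℤ → ℂ} (hb : Summable b) (hs : IsHermitianSeq b)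
    (k : ℤ × ℤ) : coeff (fun z : Torus L₁ L₂ => (fourierSeries L₁ L₂ b z).re) k = b k := by
  rw [coeff_eq]
  simp only [ofReal_re_fourierSeries hb hs]
  exact integral_expo_mul_fourierSeries hb k

/-- Convolution of sequences of Fourier coefficients. -/
def conv (a b : ℤ × ℤ → ℂ) (k : ℤ × ℤ) : ℂ := ∑' l, a l * b (k - l)

/-- The shear `(k, l) ↦ (l, k - l)` reduces this to the product of two absolutely summable families.
-/
theorem summable_norm_conv_prod {a b : ℤ × ℤ → ℂ} (ha : Summable a) (hb : Summable b) :
    Summable fun p : (ℤ × ℤ) × (ℤ × ℤ) => ‖a p.2 * b (p.1 - p.2)‖ := by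
  have h := ha.norm.mul_of_nonneg hb.norm (fun _ => norm_nonneg _) (fun _ => norm_nonneg _)
  have e : Function.Injective fun p : (ℤ × ℤ) × (ℤ × ℤ) => (p.2, p.1 - p.2) := by
    rintro ⟨p, q⟩ ⟨p', q'⟩ h
    simp only [Prod.mk.injEq] at h
    obtain ⟨rfl, h⟩ := h
    rw [sub_left_inj.1 h]
  have := h.comp_injective e
  simpa [Function.comp_def] using this

theorem summable_conv {a b : ℤ × ℤ → ℂ} (ha : Summable a) (hb : Summable b) :
    Summable (conv a b) :=
  (summable_norm_conv_prod ha hb).of_norm.prod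

theorem fourierSeries_mul {a b : ℤ × ℤ → ℂ} (ha : Summable a) (hb : Summable b)
    (z : Torus L₁ L₂) :
    fourierSeries L₁ L₂ a z * fourierSeries L₁ L₂ b z = fourierSeries L₁ L₂ (conv a b) z := by
  rw [fourierSeries_apply ha, fourierSeries_apply hb, fourierSeries_apply (summable_conv ha hb),
    tsum_mul_tsum_of_summable_norm (summable_mul_expo ha z).norm (summable_mul_expo hb z).norm]
  let e : (ℤ × ℤ) × (ℤ × ℤ) ≃ (ℤ × ℤ) × (ℤ × ℤ) :=
    { toFun := fun p => (p.2, p.1 - p.2)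
      invFun := fun p => (p.1 + p.2, p.1)
      left_inv := fun p => by ext <;> simp
      right_inv := fun p => by ext <;> simp }
  rw [← e.tsum_eq]
  have key : ∀ p : (ℤ × ℤ) × (ℤ × ℤ), a (e p).1 * expo (e p).1 z * (b (e p).2 * expo (e p).2 z)
      = a p.2 * b (p.1 - p.2) * expo p.1 z := fun p => by
    have : expo p.1 z = expo p.2 z * expo (p.1 - p.2) z := by
      rw [← expo_add, add_sub_cancel]
    rw [this]; simp only [e, Equiv.coe_fn_mk]; ring
  simp only [key]
  rw [Summable.tsum_prod]
  · simp only [conv, tsum_mul_right]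
  · refine .of_norm_bounded (summable_norm_conv_prod ha hb) fun p => ?_
    rw [norm_mul _ (expo _ _), norm_expo_apply, mul_one]

theorem IsHermitianSeq.conv {a b : ℤ × ℤ → ℂ} (ha : IsHermitianSeq a) (hb : IsHermitianSeq b) :
    IsHermitianSeq (conv a b) := fun k => by
  rw [KS2D.conv, KS2D.conv, Complex.conj_tsum, ← (Equiv.neg (ℤ × ℤ)).tsum_eq]
  congr 1; ext l
  rw [Equiv.neg_apply, ha, map_mul, ← hb]; congr 2; abel

/-- Since `⟨k⟩ ≤ ⟨l⟩ + ⟨k - l⟩`, one of the two factors carries the decay in `k` and the other is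
summed over `l`. Of `2 ^ (n + 1)`, the power `2 ^ n` comes from expanding the sum and the last
factor two from the two equal lattice sums. -/
theorem norm_conv_le {a b : ℤ × ℤ → ℂ} {A B : ℝ} {n : ℕ} (hn : 3 ≤ n) (hA : 0 ≤ A) (hB : 0 ≤ B)
    (ha : ∀ k, ‖a k‖ ≤ A * (bracket L₁ L₂ k ^ n)⁻¹)
    (hb : ∀ k, ‖b k‖ ≤ B * (bracket L₁ L₂ k ^ n)⁻¹) (k : ℤ × ℤ) :
    ‖conv a b k‖ ≤
      A * B * 2 ^ (n + 1) * (∑' l, (bracket L₁ L₂ l ^ n)⁻¹) * (bracket L₁ L₂ k ^ n)⁻¹ := by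
  have hS := summable_bracket_pow (L₁ := L₁) (L₂ := L₂) hn
  have hS' : Summable fun l => (bracket L₁ L₂ (k - l) ^ n)⁻¹ :=
    hS.comp_injective (sub_right_injective (b := k))
  have hS'' : ∑' l, (bracket L₁ L₂ (k - l) ^ n)⁻¹ = ∑' l, (bracket L₁ L₂ l ^ n)⁻¹ :=
    (Equiv.subLeft k).tsum_eq fun l => (bracket L₁ L₂ l ^ n)⁻¹
  have key : ∀ l, ‖a l * b (k - l)‖ ≤ A * B * 2 ^ n * (bracket L₁ L₂ k ^ n)⁻¹ *
      ((bracket L₁ L₂ l ^ n)⁻¹ + (bracket L₁ L₂ (k - l) ^ n)⁻¹) := fun l => by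
    have hx := bracket_pos (L₁ := L₁) (L₂ := L₂) l
    have hy := bracket_pos (L₁ := L₁) (L₂ := L₂) (k - l)
    have hz := bracket_pos (L₁ := L₁) (L₂ := L₂) k
    have hle : bracket L₁ L₂ k ^ n ≤
        2 ^ n * (bracket L₁ L₂ l ^ n + bracket L₁ L₂ (k - l) ^ n) := by
      calc bracket L₁ L₂ k ^ n ≤ (bracket L₁ L₂ l + bracket L₁ L₂ (k - l)) ^ n := by
            gcongr
            simpa using bracket_add_le (L₁ := L₁) (L₂ := L₂) l (k - l)
        _ ≤ 2 ^ (n - 1) * (bracket L₁ L₂ l ^ n + bracket L₁ L₂ (k - l) ^ n) :=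
            add_pow_le hx.le hy.le n
        _ ≤ _ := by
            gcongr
            · norm_num
            · exact n.sub_le 1
    rw [norm_mul]
    calc ‖a l‖ * ‖b (k - l)‖
        ≤ (A * (bracket L₁ L₂ l ^ n)⁻¹) * (B * (bracket L₁ L₂ (k - l) ^ n)⁻¹) :=
          mul_le_mul (ha l) (hb _) (norm_nonneg _) (by positivity)
      _ = A * B * (bracket L₁ L₂ k ^ n)⁻¹ * (bracket L₁ L₂ k ^ n) *
          ((bracket L₁ L₂ l ^ n)⁻¹ * (bracket L₁ L₂ (k - l) ^ n)⁻¹) := by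
          field_simp
      _ ≤ A * B * (bracket L₁ L₂ k ^ n)⁻¹ *
          (2 ^ n * (bracket L₁ L₂ l ^ n + bracket L₁ L₂ (k - l) ^ n)) *
          ((bracket L₁ L₂ l ^ n)⁻¹ * (bracket L₁ L₂ (k - l) ^ n)⁻¹) := by gcongr
      _ = _ := by field_simp; ring
  refine (tsum_of_norm_bounded ((hS.add hS').mul_left _).hasSum key).trans_eq ?_
  rw [tsum_mul_left, hS.tsum_add hS', hS'']; ring

end FourierSeries

/-! ### Vector fields on the torus and the quadratic term on `L²`. -/

section Fields

variable {L₁ L₂ : ℝ} [Fact (0 < L₁)] [Fact (0 < L₂)]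

/-- The real linear map `c ↦ Re(c) e_j` from `ℂ` to the plane. -/
def reSingle (j : Fin 2) : ℂ →L[ℝ] Plane :=
  Complex.reCLM.smulRight (EuclideanSpace.single j (1 : ℝ))

theorem sum_reSingle_apply (c : Fin 2 → ℂ) (j : Fin 2) : (∑ i, reSingle i (c i)) j = (c j).re := by
  fin_cases j <;> simp [reSingle]

/-- The continuous field whose components are the real parts of two Fourier series. -/
def fieldOf (L₁ L₂ : ℝ) [Fact (0 < L₁)] [Fact (0 < L₂)] (a : Fin 2 → ℤ × ℤ → ℂ) :
    C(Torus L₁ L₂, Plane) :=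
  ∑ j, (reSingle j).compLeftContinuous ℝ (Torus L₁ L₂) (fourierSeries L₁ L₂ (a j))

theorem fieldOf_apply (a : Fin 2 → ℤ × ℤ → ℂ) (z : Torus L₁ L₂) :
    fieldOf L₁ L₂ a z = ∑ j, reSingle j (fourierSeries L₁ L₂ (a j) z) := by
  rw [fieldOf, ContinuousMap.sum_apply]; rfl

theorem fieldOf_apply_apply (a : Fin 2 → ℤ × ℤ → ℂ) (z : Torus L₁ L₂) (j : Fin 2) :
    fieldOf L₁ L₂ a z j = (fourierSeries L₁ L₂ (a j) z).re := by
  rw [fieldOf_apply]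
  exact sum_reSingle_apply (fun i => fourierSeries L₁ L₂ (a i) z) j

theorem fieldOf_sub {a b : Fin 2 → ℤ × ℤ → ℂ} (ha : ∀ j, Summable (a j))
    (hb : ∀ j, Summable (b j)) :
    fieldOf L₁ L₂ (fun j k => a j k - b j k) = fieldOf L₁ L₂ a - fieldOf L₁ L₂ b := by
  ext z j
  rw [ContinuousMap.sub_apply, PiLp.sub_apply]
  simp only [fieldOf_apply_apply, fourierSeries_sub (ha j) (hb j)]
  simp

theorem norm_fieldOf_le {a : Fin 2 → ℤ × ℤ → ℂ} (ha : ∀ j, Summable (a j)) :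
    ‖fieldOf L₁ L₂ a‖ ≤ ∑ j, ∑' k, ‖a j k‖ := by
  refine (norm_sum_le _ _).trans (Finset.sum_le_sum fun j _ => ?_)
  refine le_trans ?_ (norm_fourierSeries_le (L₁ := L₁) (L₂ := L₂) (ha j))
  refine (ContinuousMap.norm_le _ (norm_nonneg _)).2 fun z => ?_
  refine le_trans ?_ (ContinuousMap.norm_coe_le_norm _ z)
  simp only [ContinuousLinearMap.compLeftContinuous_apply, reSingle]
  simpa [norm_smul] using Complex.abs_re_le_norm _

theorem continuousOn_fieldOf {X : Type*} [TopologicalSpace X] {a : X → Fin 2 → ℤ × ℤ → ℂ}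
    {s : Set X} {B : ℤ × ℤ → ℝ} (hc : ∀ j k, ContinuousOn (fun x => a x j k) s) (hB : Summable B)
    (hb : ∀ j k, ∀ x ∈ s, ‖a x j k‖ ≤ B k) :
    ContinuousOn (fun x => fieldOf L₁ L₂ (a x)) s :=
  continuousOn_finsetSum _ fun j _ =>
    ((reSingle j).compLeftContinuous ℝ (Torus L₁ L₂)).continuous.comp_continuousOn
      (continuousOn_fourierSeries (hc j) hB (hb j))

/-- The class in `L²` of `fieldOf`. -/
def fieldLp (L₁ L₂ : ℝ) [Fact (0 < L₁)] [Fact (0 < L₂)] (a : Fin 2 → ℤ × ℤ → ℂ) :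
    L2Field L₁ L₂ :=
  ContinuousMap.toLp 2 volume ℝ (fieldOf L₁ L₂ a)

theorem coeFn_fieldLp (a : Fin 2 → ℤ × ℤ → ℂ) : fieldLp L₁ L₂ a =ᵐ[volume] fieldOf L₁ L₂ a :=
  ContinuousMap.coeFn_toLp _ _

theorem coeff_fieldLp {a : Fin 2 → ℤ × ℤ → ℂ} (ha : ∀ j, Summable (a j))
    (hs : ∀ j, IsHermitianSeq (a j)) (j : Fin 2) (k : ℤ × ℤ) :
    coeff (fun z => fieldLp L₁ L₂ a z j) k = a j k := by
  rw [← coeff_re_fourierSeries (L₁ := L₁) (L₂ := L₂) (ha j) (hs j)]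
  refine coeff_congr_ae ?_ k
  filter_upwards [coeFn_fieldLp a] with z hz
  rw [hz, fieldOf_apply_apply]

theorem continuousOn_fieldLp {X : Type*} [TopologicalSpace X] {a : X → Fin 2 → ℤ × ℤ → ℂ}
    {s : Set X} {B : ℤ × ℤ → ℝ} (hc : ∀ j k, ContinuousOn (fun x => a x j k) s) (hB : Summable B)
    (hb : ∀ j k, ∀ x ∈ s, ‖a x j k‖ ≤ B k) :
    ContinuousOn (fun x => fieldLp L₁ L₂ (a x)) s :=
  (ContinuousMap.toLp 2 volume ℝ).continuous.comp_continuousOn (continuousOn_fieldOf hc hB hb)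

theorem memLp_component (f : L2Field L₁ L₂) (j : Fin 2) : MemLp (fun z => f z j) 2 :=
  (Lp.memLp f).continuousLinearMap_comp (EuclideanSpace.proj (𝕜 := ℝ) j)

/-- A square integrable field with absolutely summable Fourier coefficients is continuous. -/
theorem eq_fieldLp {a : Fin 2 → ℤ × ℤ → ℂ} (ha : ∀ j, Summable (a j))
    (hs : ∀ j, IsHermitianSeq (a j)) {f : L2Field L₁ L₂}
    (h : ∀ j k, coeff (fun z => f z j) k = a j k) : f = fieldLp L₁ L₂ a := by
  have h1 : ∀ j, (fun z => f z j) =ᵐ[volume] fun z => fieldLp L₁ L₂ a z j := fun j =>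
    ae_eq_of_coeff_eq (memLp_component f j) (memLp_component _ j) fun k => by
      rw [h, coeff_fieldLp ha hs]
  refine Lp.ext ?_
  filter_upwards [h1 0, h1 1] with z h0 h1
  ext j
  fin_cases j
  · exact h0
  · exact h1

theorem integrable_norm_sq (f : L2Field L₁ L₂) : Integrable fun z => ‖f z‖ ^ 2 :=
  (Lp.memLp f).integrable_norm_pow (by norm_num)

theorem integral_norm_sq (f : L2Field L₁ L₂) : ∫ z, ‖f z‖ ^ 2 = ‖f‖ ^ 2 := by
  rw [← real_inner_self_eq_norm_sq, L2.inner_def]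
  simp only [real_inner_self_eq_norm_sq]

/-- Pointwise `|x| ≤ 1 + |x|²`. Only boundedness in `k` is ever used, so a crude constant is enough.
-/
theorem norm_coeff_component_le (f : L2Field L₁ L₂) (j : Fin 2) (k : ℤ × ℤ) :
    ‖coeff (fun z => f z j) k‖ ≤ (L₁ * L₂)⁻¹ * (L₁ * L₂ + ‖f‖ ^ 2) := by
  refine (norm_coeff_le _ k).trans ?_
  have := area_pos (L₁ := L₁) (L₂ := L₂)
  gcongr
  have h1 : ∫ _ : Torus L₁ L₂, (1 : ℝ) = L₁ * L₂ := by
    have := integral_expo (L₁ := L₁) (L₂ := L₂) 0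
    rw [if_pos rfl] at this
    have h2 : ∫ z : Torus L₁ L₂, expo 0 z = ((∫ _ : Torus L₁ L₂, (1 : ℝ) : ℝ) : ℂ) := by
      rw [← integral_complex_ofReal]; simp [expo_zero]
    rw [h2] at this
    exact_mod_cast this
  rw [← h1, ← integral_norm_sq, ← integral_add (integrable_const _) (integrable_norm_sq f)]
  refine integral_mono ((memLp_component f j).integrable one_le_two).abs
    ((integrable_const _).add (integrable_norm_sq f)) fun z => ?_
  have := PiLp.norm_apply_le (f z) j
  rw [Real.norm_eq_abs] at this
  dsimp only
  nlinarith [sq_nonneg (‖f z‖ - 1), norm_nonneg (f z)]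

/-- The Fourier coefficients of `|f|² / 2`. -/
def quad (f : L2Field L₁ L₂) (k : ℤ × ℤ) : ℂ := coeff (fun z => ‖f z‖ ^ 2 / 2) k

theorem isHermitianSeq_quad (f : L2Field L₁ L₂) : IsHermitianSeq (quad f) :=
  fun k => coeff_neg_index _ k

theorem norm_quad_le (f : L2Field L₁ L₂) (k : ℤ × ℤ) :
    ‖quad f k‖ ≤ (L₁ * L₂)⁻¹ * ‖f‖ ^ 2 := by
  refine (norm_coeff_le _ k).trans ?_
  have := area_pos (L₁ := L₁) (L₂ := L₂)
  gcongr
  rw [← integral_norm_sq]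
  refine integral_mono ((integrable_norm_sq f).div_const 2).abs (integrable_norm_sq f) fun z => ?_
  dsimp only
  rw [abs_of_nonneg (by positivity)]
  linarith [sq_nonneg ‖f z‖]

/-- Local Lipschitz continuity of the nonlinearity, from `||f|² - |g|²| ≤ |f - g| (|f| + |g|)`. The
product is split by Young's inequality with weight `d = ‖f - g‖`, so that both terms integrate to
multiples of `d`. -/
theorem norm_quad_sub_le (f g : L2Field L₁ L₂) (k : ℤ × ℤ) :
    ‖quad f k - quad g k‖ ≤ (L₁ * L₂)⁻¹ * ((1 + ‖f‖ ^ 2 + ‖g‖ ^ 2) * ‖f - g‖) := by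
  rcases eq_or_ne f g with rfl | hfg
  · simp
  have hd : 0 < ‖f - g‖ := norm_pos_iff.2 (sub_ne_zero.2 hfg)
  have hf := (integrable_norm_sq f).div_const 2
  have hg := (integrable_norm_sq g).div_const 2
  rw [quad, quad, ← coeff_sub hf hg]
  refine (norm_coeff_le _ k).trans ?_
  have := area_pos (L₁ := L₁) (L₂ := L₂)
  gcongr
  set d := ‖f - g‖
  have hi : Integrable fun z => (‖f z - g z‖ ^ 2 / d + d * (2 * ‖f z‖ ^ 2 + 2 * ‖g z‖ ^ 2)) / 2 := by
    refine Integrable.div_const (.add (.div_const ?_ d) (.const_mul (.add ?_ ?_) d)) 2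
    · exact (integrable_norm_sq (f - g)).congr
        ((Lp.coeFn_sub f g).mono fun z hz => by simp only [hz, Pi.sub_apply])
    · exact (integrable_norm_sq f).const_mul 2
    · exact (integrable_norm_sq g).const_mul 2
  calc ∫ z, |‖f z‖ ^ 2 / 2 - ‖g z‖ ^ 2 / 2|
      ≤ ∫ z, (‖f z - g z‖ ^ 2 / d + d * (2 * ‖f z‖ ^ 2 + 2 * ‖g z‖ ^ 2)) / 2 := by
        refine integral_mono (hf.sub hg).abs hi fun z => ?_
        dsimp only
        have h1 : |‖f z‖ - ‖g z‖| ≤ ‖f z - g z‖ := abs_norm_sub_norm_le _ _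
        have h2 : |‖f z‖ ^ 2 / 2 - ‖g z‖ ^ 2 / 2| = |‖f z‖ - ‖g z‖| * (‖f z‖ + ‖g z‖) / 2 := by
          rw [show ‖f z‖ ^ 2 / 2 - ‖g z‖ ^ 2 / 2 = (‖f z‖ - ‖g z‖) * ((‖f z‖ + ‖g z‖) / 2) by ring,
            abs_mul, abs_of_nonneg (show 0 ≤ (‖f z‖ + ‖g z‖) / 2 by positivity)]
          ring
        rw [h2]
        -- Young's inequality, with the deficit written as `d` times a sum of squares.
        have h3 : ‖f z - g z‖ * (‖f z‖ + ‖g z‖) ≤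
            ‖f z - g z‖ ^ 2 / d + d * (2 * ‖f z‖ ^ 2 + 2 * ‖g z‖ ^ 2) := by
          have e : ‖f z - g z‖ ^ 2 / d + d * (2 * ‖f z‖ ^ 2 + 2 * ‖g z‖ ^ 2)
              - ‖f z - g z‖ * (‖f z‖ + ‖g z‖) =
              d * ((‖f z - g z‖ / d - (‖f z‖ + ‖g z‖) / 2) ^ 2
                + 3 / 4 * (‖f z‖ + ‖g z‖) ^ 2 + (‖f z‖ - ‖g z‖) ^ 2) := by
            field_simp; ring
          have : 0 ≤ d * ((‖f z - g z‖ / d - (‖f z‖ + ‖g z‖) / 2) ^ 2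
                + 3 / 4 * (‖f z‖ + ‖g z‖) ^ 2 + (‖f z‖ - ‖g z‖) ^ 2) := by positivity
          linarith
        have h4 := mul_le_mul_of_nonneg_right h1 (show 0 ≤ ‖f z‖ + ‖g z‖ by positivity)
        linarith
    _ = (d + d * (2 * ‖f‖ ^ 2 + 2 * ‖g‖ ^ 2)) / 2 := by
        have e : ∫ z, ‖f z - g z‖ ^ 2 = d ^ 2 := by
          rw [← integral_norm_sq]
          exact integral_congr_ae
            ((Lp.coeFn_sub f g).mono fun z hz => by simp only [hz, Pi.sub_apply])
        have i1 : Integrable fun z => ‖f z - g z‖ ^ 2 := (integrable_norm_sq (f - g)).congr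
          ((Lp.coeFn_sub f g).mono fun z hz => by simp only [hz, Pi.sub_apply])
        have i2 := (integrable_norm_sq f).const_mul 2
        have i3 := (integrable_norm_sq g).const_mul 2
        have i4 : Integrable fun z => d * (2 * ‖f z‖ ^ 2 + 2 * ‖g z‖ ^ 2) := (i2.add i3).const_mul d
        rw [integral_div, integral_add (i1.div_const d) i4, integral_div, e,
          integral_const_mul, integral_add i2 i3, integral_const_mul, integral_const_mul,
          integral_norm_sq, integral_norm_sq]
        congr 2
        field_simp
    _ ≤ _ := by nlinarith

theorem continuousOn_quad {s : Set ℝ} {u : ℝ → L2Field L₁ L₂} (hu : ContinuousOn u s)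
    (k : ℤ × ℤ) : ContinuousOn (fun t => quad (u t) k) s := by
  have hq : Continuous fun f : L2Field L₁ L₂ => quad f k := by
    rw [continuous_iff_continuousAt]
    intro g
    rw [ContinuousAt, tendsto_iff_norm_sub_tendsto_zero]
    have hc : Continuous fun f : L2Field L₁ L₂ =>
        (L₁ * L₂)⁻¹ * ((1 + ‖f‖ ^ 2 + ‖g‖ ^ 2) * ‖f - g‖) := by fun_prop
    refine squeeze_zero (fun _ => norm_nonneg _) (fun f => norm_quad_sub_le f g k) ?_
    simpa using hc.tendsto g
  exact hq.comp_continuousOn hu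

/-- For a field with absolutely summable coefficients, those of `|f|² / 2` are convolutions. -/
theorem quad_fieldLp {a : Fin 2 → ℤ × ℤ → ℂ} (ha : ∀ j, Summable (a j))
    (hs : ∀ j, IsHermitianSeq (a j)) (k : ℤ × ℤ) :
    quad (fieldLp L₁ L₂ a) k = (conv (a 0) (a 0) k + conv (a 1) (a 1) k) / 2 := by
  have hb : Summable fun k => (conv (a 0) (a 0) k + conv (a 1) (a 1) k) / 2 :=
    ((summable_conv (ha 0) (ha 0)).add (summable_conv (ha 1) (ha 1))).div_const 2
  have h0 := summable_conv (ha 0) (ha 0)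
  have h1 := summable_conv (ha 1) (ha 1)
  rw [quad, coeff_eq, ← integral_expo_mul_fourierSeries (L₁ := L₁) (L₂ := L₂) hb k]
  congr 1
  refine integral_congr_ae ?_
  filter_upwards [coeFn_fieldLp a] with z hz
  rw [hz]
  congr 1
  rw [EuclideanSpace.norm_sq_eq, Fin.sum_univ_two, fieldOf_apply_apply, fieldOf_apply_apply,
    Real.norm_eq_abs, Real.norm_eq_abs, sq_abs, sq_abs]
  push_cast
  rw [ofReal_re_fourierSeries (ha 0) (hs 0), ofReal_re_fourierSeries (ha 1) (hs 1), sq, sq,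
    fourierSeries_mul (ha 0) (ha 0), fourierSeries_mul (ha 1) (ha 1), fourierSeries_apply hb,
    fourierSeries_apply h0, fourierSeries_apply h1,
    ← (summable_mul_expo h0 z).tsum_add (summable_mul_expo h1 z), ← tsum_div_const]
  congr 1; ext l; ring

end Fields

/-! ### The linear equation with forcing: restart, smoothing and kernel bounds. -/

section Duhamel

variable (L₁ L₂ : ℝ)

/-- The `k`-th coefficient of the Duhamel integral with forcing `∂_j g`, where `g(s)` has the
Fourier coefficients `G s`. -/
def duh (G : ℝ → ℤ × ℤ → ℂ) (j : Fin 2) (k : ℤ × ℤ) (t : ℝ) : ℂ :=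
  Complex.I * (freq L₁ L₂ k j : ℂ) *
    ∫ s in (0 : ℝ)..t, (Real.exp (-(t - s) * symb L₁ L₂ k) : ℂ) * G s k

/-- The coefficients at time `t` of the solution of the linear equation with initial
coefficients `c` and forcing coefficients `G`. -/
def mildCoeff (c : Fin 2 → ℤ × ℤ → ℂ) (G : ℝ → ℤ × ℤ → ℂ) (t : ℝ) (j : Fin 2) (k : ℤ × ℤ) : ℂ :=
  (Real.exp (-t * symb L₁ L₂ k) : ℂ) * c j k - duh L₁ L₂ G j k t

variable {L₁ L₂}

/-- With `e^{-tσ}` pulled out, the integrand no longer depends on `t`; continuity, differentiation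
and restarting in `t` become statements about a primitive. -/
theorem duh_eq (G : ℝ → ℤ × ℤ → ℂ) (j : Fin 2) (k : ℤ × ℤ) (t : ℝ) :
    duh L₁ L₂ G j k t = Complex.I * (freq L₁ L₂ k j : ℂ) * ((Real.exp (-t * symb L₁ L₂ k) : ℂ) *
      ∫ s in (0 : ℝ)..t, (Real.exp (s * symb L₁ L₂ k) : ℂ) * G s k) := by
  rw [duh]
  congr 1
  rw [← intervalIntegral.integral_const_mul]
  congr 1; ext s
  rw [← mul_assoc, ← Complex.ofReal_mul, ← Real.exp_add]
  congr 3; ring_nf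

/-- The endpoint is a null set. The half-open interval lets a forcing known only before `T`
determine the integral at `T`. -/
theorem duh_congr {G G' : ℝ → ℤ × ℤ → ℂ} {t : ℝ} (ht : 0 ≤ t) {k : ℤ × ℤ}
    (h : ∀ s ∈ Set.Ico 0 t, G s k = G' s k) (j : Fin 2) :
    duh L₁ L₂ G j k t = duh L₁ L₂ G' j k t := by
  rw [duh, duh]
  congr 1
  refine intervalIntegral.integral_congr_ae ?_
  filter_upwards [compl_mem_ae_iff.2 (measure_singleton t)] with s hs hs'
  rw [Set.uIoc_of_le ht] at hs'
  rw [h s ⟨hs'.1.le, lt_of_le_of_ne hs'.2 hs⟩]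

theorem intervalIntegrable_exp_mul {G : ℝ → ℤ × ℤ → ℂ} {k : ℤ × ℤ} {a b : ℝ}
    (hG : IntervalIntegrable (fun s => G s k) volume a b) (σ : ℝ) :
    IntervalIntegrable (fun s => (Real.exp (s * σ) : ℂ) * G s k) volume a b :=
  hG.continuousOn_mul (by fun_prop)

theorem intervalIntegrable_exp_sub_mul {G : ℝ → ℤ × ℤ → ℂ} {k : ℤ × ℤ} {a b : ℝ}
    (hG : IntervalIntegrable (fun s => G s k) volume a b) (t σ : ℝ) :
    IntervalIntegrable (fun s => (Real.exp (-(t - s) * σ) : ℂ) * G s k) volume a b :=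
  hG.continuousOn_mul (by fun_prop)

theorem duh_sub {G G' : ℝ → ℤ × ℤ → ℂ} {k : ℤ × ℤ} {t : ℝ}
    (hG : IntervalIntegrable (fun s => G s k) volume 0 t)
    (hG' : IntervalIntegrable (fun s => G' s k) volume 0 t) (j : Fin 2) :
    duh L₁ L₂ G j k t - duh L₁ L₂ G' j k t = duh L₁ L₂ (fun s l => G s l - G' s l) j k t := by
  rw [duh, duh, duh, ← mul_sub, ← intervalIntegral.integral_sub
    (intervalIntegrable_exp_sub_mul hG t _) (intervalIntegrable_exp_sub_mul hG' t _)]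
  simp only [mul_sub]

/-- Restarting at `t₀`: the semigroup law for the exponentials and a splitting of the integral at
`t₀`. -/
theorem mildCoeff_add {c : Fin 2 → ℤ × ℤ → ℂ} {G : ℝ → ℤ × ℤ → ℂ} {k : ℤ × ℤ} {t₀ t : ℝ}
    (h₀ : IntervalIntegrable (fun s => G s k) volume 0 t₀)
    (h : IntervalIntegrable (fun s => G s k) volume t₀ (t₀ + t)) (j : Fin 2) :
    mildCoeff L₁ L₂ c G (t₀ + t) j k =
      mildCoeff L₁ L₂ (mildCoeff L₁ L₂ c G t₀) (fun s => G (t₀ + s)) t j k := by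
  have e1 : ∫ s in (0 : ℝ)..(t₀ + t), (Real.exp (s * symb L₁ L₂ k) : ℂ) * G s k =
      (∫ s in (0 : ℝ)..t₀, (Real.exp (s * symb L₁ L₂ k) : ℂ) * G s k) +
      (Real.exp (t₀ * symb L₁ L₂ k) : ℂ) *
        ∫ s in (0 : ℝ)..t, (Real.exp (s * symb L₁ L₂ k) : ℂ) * G (t₀ + s) k := by
    rw [← intervalIntegral.integral_add_adjacent_intervals (intervalIntegrable_exp_mul h₀ _)
      (intervalIntegrable_exp_mul h _)]
    congr 1
    have := intervalIntegral.integral_comp_add_left (a := 0) (b := t)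
      (fun s => (Real.exp (s * symb L₁ L₂ k) : ℂ) * G s k) t₀
    rw [add_zero] at this
    rw [← this, ← intervalIntegral.integral_const_mul]
    congr 1; ext s
    rw [← mul_assoc, ← Complex.ofReal_mul, ← Real.exp_add, ← add_mul]
  have e2 : (Real.exp (-(t₀ + t) * symb L₁ L₂ k) : ℂ) =
      (Real.exp (-t * symb L₁ L₂ k) : ℂ) * (Real.exp (-t₀ * symb L₁ L₂ k) : ℂ) := by
    rw [← Complex.ofReal_mul, ← Real.exp_add]; congr 2; ring
  have e3 : (Real.exp (-t₀ * symb L₁ L₂ k) : ℂ) * (Real.exp (t₀ * symb L₁ L₂ k) : ℂ) = 1 := by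
    rw [← Complex.ofReal_mul, ← Real.exp_add, neg_mul, neg_add_cancel, Real.exp_zero,
      Complex.ofReal_one]
  simp only [mildCoeff, duh_eq, e1, e2]
  linear_combination (-Complex.I * (freq L₁ L₂ k j : ℂ) * (Real.exp (-t * symb L₁ L₂ k) : ℂ) *
    (∫ s in (0 : ℝ)..t, (Real.exp (s * symb L₁ L₂ k) : ℂ) * G (t₀ + s) k)) * e3

theorem continuousOn_mildCoeff (c : Fin 2 → ℤ × ℤ → ℂ) {G : ℝ → ℤ × ℤ → ℂ} {k : ℤ × ℤ} {T : ℝ}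
    (hT : 0 ≤ T) (hG : IntervalIntegrable (fun s => G s k) volume 0 T) (j : Fin 2) :
    ContinuousOn (fun t => mildCoeff L₁ L₂ c G t j k) (Set.Icc 0 T) := by
  have h1 := intervalIntegral.continuousOn_primitive_interval (μ := volume) (a := 0) (b := T)
    (f := fun s => (Real.exp (s * symb L₁ L₂ k) : ℂ) * G s k) (by
      rw [Set.uIcc_of_le hT, integrableOn_Icc_iff_integrableOn_Ioc,
        ← intervalIntegrable_iff_integrableOn_Ioc_of_le hT]
      exact intervalIntegrable_exp_mul hG _)
  rw [Set.uIcc_of_le hT] at h1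
  have h2 : ContinuousOn (fun t : ℝ => (Real.exp (-t * symb L₁ L₂ k) : ℂ)) (Set.Icc 0 T) := by
    fun_prop
  simp only [mildCoeff, duh_eq]
  exact (h2.mul continuousOn_const).sub (continuousOn_const.mul (h2.mul h1))

theorem hasDerivAt_mildCoeff (c : Fin 2 → ℤ × ℤ → ℂ) {G : ℝ → ℤ × ℤ → ℂ} {k : ℤ × ℤ} {T t : ℝ}
    (hG : ContinuousOn (fun s => G s k) (Set.Icc 0 T)) (ht : t ∈ Set.Ioo 0 T) (j : Fin 2) :
    HasDerivAt (fun t => mildCoeff L₁ L₂ c G t j k)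
      (-(symb L₁ L₂ k : ℂ) * mildCoeff L₁ L₂ c G t j k
        - Complex.I * (freq L₁ L₂ k j : ℂ) * G t k) t := by
  have hT : 0 ≤ T := (ht.1.trans ht.2).le
  set σ := symb L₁ L₂ k with hσ
  have hc : ContinuousOn (fun s => (Real.exp (s * σ) : ℂ) * G s k) (Set.Icc 0 T) :=
    ContinuousOn.mul (by fun_prop) hG
  have hn : Set.Icc 0 T ∈ nhds t := Icc_mem_nhds ht.1 ht.2
  have h1 : HasDerivAt (fun t => ∫ s in (0 : ℝ)..t, (Real.exp (s * σ) : ℂ) * G s k)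
      ((Real.exp (t * σ) : ℂ) * G t k) t := by
    refine intervalIntegral.integral_hasDerivAt_right ?_ ?_ (hc.continuousAt hn)
    · refine (hc.mono ?_).intervalIntegrable
      rw [Set.uIcc_of_le ht.1.le]
      exact Set.Icc_subset_Icc_right ht.2.le
    · exact ⟨Set.Icc 0 T, hn, hc.aestronglyMeasurable measurableSet_Icc⟩
  have h2 : HasDerivAt (fun t : ℝ => (Real.exp (-t * σ) : ℂ)) ((Real.exp (-t * σ) * -σ : ℝ) : ℂ)
      t := by
    refine HasDerivAt.ofReal_comp ?_
    have := ((hasDerivAt_id t).neg.mul_const σ).exp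
    simpa using this
  have h3 := (h2.mul_const (c j k)).sub
    ((h2.mul h1).const_mul (Complex.I * (freq L₁ L₂ k j : ℂ)))
  have e3 : (Real.exp (-t * σ) : ℂ) * (Real.exp (t * σ) : ℂ) = 1 := by
    rw [← Complex.ofReal_mul, ← Real.exp_add, neg_mul, neg_add_cancel, Real.exp_zero,
      Complex.ofReal_one]
  simp only [mildCoeff, duh_eq, ← hσ]
  refine h3.congr_deriv ?_
  push_cast at e3 ⊢
  linear_combination (-Complex.I * (freq L₁ L₂ k j : ℂ) * G t k) * e3

theorem exp_neg_mul_symb_le {t : ℝ} (ht : 0 ≤ t) (k : ℤ × ℤ) :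
    Real.exp (-t * symb L₁ L₂ k) ≤ Real.exp t * Real.exp (-t * (bracket L₁ L₂ k ^ 4 / 4)) := by
  rw [← Real.exp_add]
  refine Real.exp_le_exp.2 ?_
  nlinarith [mul_le_mul_of_nonneg_left (le_symb (L₁ := L₁) (L₂ := L₂) k) ht]

theorem exp_neg_mul_symb_le_exp {t : ℝ} (ht : 0 ≤ t) (k : ℤ × ℤ) :
    Real.exp (-t * symb L₁ L₂ k) ≤ Real.exp t := by
  refine (exp_neg_mul_symb_le ht k).trans (mul_le_of_le_one_right (Real.exp_pos _).le ?_)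
  refine Real.exp_le_one_iff.2 ?_
  have := bracket_pos (L₁ := L₁) (L₂ := L₂) k
  have : 0 ≤ t * (bracket L₁ L₂ k ^ 4 / 4) := by positivity
  linarith

/-- Instantaneous smoothing by the linear semigroup. -/
theorem exp_neg_mul_symb_le_pow {ε t T : ℝ} (hε : 0 < ε) (h1 : ε ≤ t) (h2 : t ≤ T) (n : ℕ)
    (k : ℤ × ℤ) : Real.exp (-t * symb L₁ L₂ k) ≤
      Real.exp T * (n.factorial * (4 / ε) ^ n) * (bracket L₁ L₂ k ^ n)⁻¹ := by
  have hr := bracket_pos (L₁ := L₁) (L₂ := L₂) k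
  have hr1 := one_le_bracket (L₁ := L₁) (L₂ := L₂) k
  refine (exp_neg_mul_symb_le (hε.le.trans h1) k).trans ?_
  rw [mul_assoc]
  refine mul_le_mul (Real.exp_le_exp.2 h2) ?_ (Real.exp_pos _).le (Real.exp_pos _).le
  -- The constant comes from `x ^ n / n! ≤ exp x` at `x = ε⟨k⟩/4`, after lowering `⟨k⟩⁴` to `⟨k⟩ ≥
  -- 1`.
  have hx : 0 < ε / 4 * bracket L₁ L₂ k := by positivity
  have h3 := Real.pow_div_factorial_le_exp (ε / 4 * bracket L₁ L₂ k) hx.le n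
  have h4 : Real.exp (-t * (bracket L₁ L₂ k ^ 4 / 4)) ≤
      (Real.exp (ε / 4 * bracket L₁ L₂ k))⁻¹ := by
    rw [← Real.exp_neg]
    refine Real.exp_le_exp.2 ?_
    have h5 : bracket L₁ L₂ k ≤ bracket L₁ L₂ k ^ 4 := le_self_pow₀ hr1 (by norm_num)
    have h6 := mul_le_mul h1 h5 hr.le (hε.le.trans h1)
    linarith
  refine h4.trans ((inv_anti₀ (by positivity) h3).trans_eq ?_)
  rw [mul_pow, div_pow, div_pow]
  field_simp

theorem integral_exp_neg_le {t R : ℝ} (hR : 0 < R) :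
    ∫ s in (0 : ℝ)..t, Real.exp (-(t - s) * R) ≤ R⁻¹ := by
  have h : ∀ s ∈ Set.uIcc 0 t, HasDerivAt (fun s => R⁻¹ * Real.exp (-(t - s) * R))
      (Real.exp (-(t - s) * R)) s := fun s _ => by
    have := (((((hasDerivAt_id s).const_sub t).neg).mul_const R).exp).const_mul R⁻¹
    refine this.congr_deriv ?_
    simp only [id, Pi.neg_apply]
    field_simp
  rw [intervalIntegral.integral_eq_sub_of_hasDerivAt h
    (Continuous.intervalIntegrable (by fun_prop) _ _)]
  have : 0 < R⁻¹ * Real.exp (-(t - 0) * R) := by positivity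
  have e : R⁻¹ * Real.exp (-(t - t) * R) = R⁻¹ := by simp
  linarith

/-- The time integral of `e^{-(t-s)⟨k⟩⁴/4}` is at most `t` and at most `4/⟨k⟩⁴`. The minimum keeps
both: the second gives decay in `k`, the first gives smallness for short times. -/
theorem norm_duh_le {G : ℝ → ℤ × ℤ → ℂ} {k : ℤ × ℤ} {t M : ℝ} (ht : 0 ≤ t) (hM : 0 ≤ M)
    (hG : ∀ s ∈ Set.Ico 0 t, ‖G s k‖ ≤ M) (j : Fin 2) :
    ‖duh L₁ L₂ G j k t‖ ≤
      M * Real.exp t * (bracket L₁ L₂ k * min t (4 / bracket L₁ L₂ k ^ 4)) := by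
  have hr := bracket_pos (L₁ := L₁) (L₂ := L₂) k
  set R := bracket L₁ L₂ k ^ 4 / 4 with hR
  have hR0 : 0 < R := by positivity
  have key : ∀ᵐ s, s ∈ Set.Ioc 0 t → ‖(Real.exp (-(t - s) * symb L₁ L₂ k) : ℂ) * G s k‖ ≤
      M * Real.exp t * Real.exp (-(t - s) * R) := by
    filter_upwards [compl_mem_ae_iff.2 (measure_singleton t)] with s hs hs'
    have hst : s < t := lt_of_le_of_ne hs'.2 hs
    rw [norm_mul, Complex.norm_real, Real.norm_of_nonneg (Real.exp_pos _).le]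
    have h1 := exp_neg_mul_symb_le (L₁ := L₁) (L₂ := L₂) (sub_nonneg.2 hst.le) k
    have h2 := hG s ⟨hs'.1.le, hst⟩
    calc _ ≤ (Real.exp (t - s) * Real.exp (-(t - s) * R)) * M := by gcongr
      _ ≤ (Real.exp t * Real.exp (-(t - s) * R)) * M := by gcongr; linarith [hs'.1]
      _ = _ := by ring
  have h1 := intervalIntegral.norm_integral_le_of_norm_le ht key
    (Continuous.intervalIntegrable (by fun_prop) _ _)
  have h2 : ∫ s in (0 : ℝ)..t, M * Real.exp t * Real.exp (-(t - s) * R) ≤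
      M * Real.exp t * min t (4 / bracket L₁ L₂ k ^ 4) := by
    rw [intervalIntegral.integral_const_mul]
    gcongr
    refine le_min ?_ ?_
    · have : ∫ s in (0 : ℝ)..t, Real.exp (-(t - s) * R) ≤ ∫ _ in (0 : ℝ)..t, (1 : ℝ) := by
        refine intervalIntegral.integral_mono_on ht
          (Continuous.intervalIntegrable (by fun_prop) _ _) (by simp) fun s hs => ?_
        refine Real.exp_le_one_iff.2 ?_
        nlinarith [mul_nonneg (sub_nonneg.2 hs.2) hR0.le]
      simpa using this
    · refine (integral_exp_neg_le hR0).trans_eq ?_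
      rw [hR, inv_div]
  rw [duh, norm_mul, norm_mul, Complex.norm_I, one_mul, Complex.norm_real, Real.norm_eq_abs]
  calc _ ≤ bracket L₁ L₂ k * (M * Real.exp t * min t (4 / bracket L₁ L₂ k ^ 4)) :=
        mul_le_mul (abs_freq_le k j) (h1.trans h2) (norm_nonneg _) hr.le
    _ = _ := by ring

/-- Parabolic regularity: the solution of the linear equation gains three derivatives over the
potential of its forcing. -/
theorem norm_mildCoeff_le {c : Fin 2 → ℤ × ℤ → ℂ} {G : ℝ → ℤ × ℤ → ℂ} {j : Fin 2} {k : ℤ × ℤ}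
    {ε t T M₀ M : ℝ} {n : ℕ} (hε : 0 < ε) (h1 : ε ≤ t) (h2 : t ≤ T) (hM : 0 ≤ M)
    (hc : ‖c j k‖ ≤ M₀) (hG : ∀ s ∈ Set.Ico 0 t, ‖G s k‖ ≤ M * (bracket L₁ L₂ k ^ n)⁻¹) :
    ‖mildCoeff L₁ L₂ c G t j k‖ ≤
      Real.exp T * ((n + 3).factorial * (4 / ε) ^ (n + 3) * M₀ + 4 * M) *
        (bracket L₁ L₂ k ^ (n + 3))⁻¹ := by
  have hr := bracket_pos (L₁ := L₁) (L₂ := L₂) k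
  have ht : 0 ≤ t := hε.le.trans h1
  have hM₀ : 0 ≤ M₀ := (norm_nonneg _).trans hc
  have a1 := exp_neg_mul_symb_le_pow (L₁ := L₁) (L₂ := L₂) hε h1 h2 (n + 3) k
  have a2 := norm_duh_le (L₁ := L₁) (L₂ := L₂) ht (by positivity) hG j
  have a3 : M * (bracket L₁ L₂ k ^ n)⁻¹ * Real.exp t *
      (bracket L₁ L₂ k * min t (4 / bracket L₁ L₂ k ^ 4)) ≤
      Real.exp T * (4 * M) * (bracket L₁ L₂ k ^ (n + 3))⁻¹ := by
    calc _ ≤ M * (bracket L₁ L₂ k ^ n)⁻¹ * Real.exp T *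
          (bracket L₁ L₂ k * (4 / bracket L₁ L₂ k ^ 4)) := by
          gcongr
          exact min_le_right _ _
      _ = _ := by rw [pow_add]; field_simp
  rw [mildCoeff]
  refine (norm_sub_le _ _).trans ?_
  rw [norm_mul, Complex.norm_real, Real.norm_of_nonneg (Real.exp_pos _).le]
  have a4 := mul_le_mul a1 hc (norm_nonneg _) (by positivity)
  calc _ ≤ _ := add_le_add a4 (a2.trans a3)
    _ = _ := by ring

/-- The symbol is real and even, and the multiplier `iκ_j` passes to its conjugate under `k ↦ -k`.
-/
theorem isHermitianSeq_mildCoeff {c : Fin 2 → ℤ × ℤ → ℂ} {G : ℝ → ℤ × ℤ → ℂ}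
    (hc : ∀ j, IsHermitianSeq (c j)) (hG : ∀ s, IsHermitianSeq (G s)) (t : ℝ) (j : Fin 2) :
    IsHermitianSeq (mildCoeff L₁ L₂ c G t j) := fun k => by
  have h : ∫ s in (0 : ℝ)..t, (Real.exp (-(t - s) * symb L₁ L₂ k) : ℂ) * G s (-k) =
      (starRingEnd ℂ) (∫ s in (0 : ℝ)..t, (Real.exp (-(t - s) * symb L₁ L₂ k) : ℂ) * G s k) := by
    rw [← intervalIntegral.intervalIntegral_conj]
    congr 1; ext s
    rw [hG s k, map_mul, Complex.conj_ofReal]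
  rw [mildCoeff, mildCoeff, duh, duh, symb_neg, freq_neg, h, hc j k]
  simp only [map_sub, map_mul, Complex.conj_ofReal, Complex.conj_I, Complex.ofReal_neg]
  ring

variable (L₁ L₂) in
/-- The norm of the Duhamel operator on a time interval of length `τ`, up to a constant. -/
def smoothing (τ : ℝ) : ℝ := ∑' k, bracket L₁ L₂ k * min τ (4 / bracket L₁ L₂ k ^ 4)

theorem bracket_mul_min_le (τ : ℝ) (k : ℤ × ℤ) :
    bracket L₁ L₂ k * min τ (4 / bracket L₁ L₂ k ^ 4) ≤ 4 * (bracket L₁ L₂ k ^ 3)⁻¹ := by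
  have hr := bracket_pos (L₁ := L₁) (L₂ := L₂) k
  calc _ ≤ bracket L₁ L₂ k * (4 / bracket L₁ L₂ k ^ 4) := by
        gcongr; exact min_le_right _ _
    _ = _ := by field_simp

theorem bracket_mul_min_nonneg {τ : ℝ} (hτ : 0 ≤ τ) (k : ℤ × ℤ) :
    0 ≤ bracket L₁ L₂ k * min τ (4 / bracket L₁ L₂ k ^ 4) := by
  have hr := bracket_pos (L₁ := L₁) (L₂ := L₂) k
  have := le_min hτ (show 0 ≤ 4 / bracket L₁ L₂ k ^ 4 by positivity)
  positivity

variable [Fact (0 < L₁)] [Fact (0 < L₂)]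

theorem summable_bracket_mul_min {τ : ℝ} (hτ : 0 ≤ τ) :
    Summable fun k => bracket L₁ L₂ k * min τ (4 / bracket L₁ L₂ k ^ 4) :=
  .of_nonneg_of_le (bracket_mul_min_nonneg hτ) (bracket_mul_min_le τ)
    ((summable_bracket_pow le_rfl).mul_left 4)

/-- Dominated convergence with majorant `4⟨k⟩⁻³`. This is the source of the short existence time in
the contraction argument. -/
theorem tendsto_smoothing :
    Filter.Tendsto (smoothing L₁ L₂) (nhdsWithin 0 (Set.Ioi 0)) (nhds 0) := by
  have h0 : ∑' _ : ℤ × ℤ, (0 : ℝ) = 0 := tsum_zero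
  suffices h : Filter.Tendsto (smoothing L₁ L₂) (nhdsWithin 0 (Set.Ioi 0))
      (nhds (∑' _ : ℤ × ℤ, (0 : ℝ))) by rwa [h0] at h
  refine tendsto_tsum_of_dominated_convergence
    ((summable_bracket_pow (L₁ := L₁) (L₂ := L₂) le_rfl).mul_left 4) (fun k => ?_) ?_
  · have hr := bracket_pos (L₁ := L₁) (L₂ := L₂) k
    have hc : Continuous fun τ : ℝ => bracket L₁ L₂ k * min τ (4 / bracket L₁ L₂ k ^ 4) := by
      fun_prop
    have := hc.tendsto 0
    rw [min_eq_left (by positivity), mul_zero] at this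
    exact this.mono_left nhdsWithin_le_nhds
  · filter_upwards [self_mem_nhdsWithin] with τ hτ k
    rw [Real.norm_of_nonneg (bracket_mul_min_nonneg (le_of_lt hτ) k)]
    exact bracket_mul_min_le τ k

end Duhamel

/-! ### Local existence by contraction, and continuation beyond `T`. -/

section Existence

variable {L₁ L₂ : ℝ}

/-- A bound on the coefficients of the solution of the linear equation, uniform on `[0, τ]`. -/
theorem norm_mildCoeff_le_add {c : Fin 2 → ℤ × ℤ → ℂ} {G : ℝ → ℤ × ℤ → ℂ} {j : Fin 2}
    {k : ℤ × ℤ} {t τ M : ℝ} (ht : 0 ≤ t) (htτ : t ≤ τ) (hM : 0 ≤ M)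
    (hG : ∀ s ∈ Set.Ico 0 t, ‖G s k‖ ≤ M) :
    ‖mildCoeff L₁ L₂ c G t j k‖ ≤ Real.exp τ * ‖c j k‖ +
      M * Real.exp τ * (bracket L₁ L₂ k * min τ (4 / bracket L₁ L₂ k ^ 4)) := by
  have hr := bracket_pos (L₁ := L₁) (L₂ := L₂) k
  have a1 := norm_duh_le (L₁ := L₁) (L₂ := L₂) ht hM hG j
  have a2 := exp_neg_mul_symb_le_exp (L₁ := L₁) (L₂ := L₂) ht k
  have a3 := bracket_mul_min_nonneg (L₁ := L₁) (L₂ := L₂) ht k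
  rw [mildCoeff]
  refine (norm_sub_le _ _).trans ?_
  rw [norm_mul, Complex.norm_real, Real.norm_of_nonneg (Real.exp_pos _).le]
  refine add_le_add ?_ (a1.trans ?_)
  · exact mul_le_mul_of_nonneg_right (a2.trans (Real.exp_le_exp.2 htτ)) (norm_nonneg _)
  · gcongr

variable [Fact (0 < L₁)] [Fact (0 < L₂)]

theorem fieldLp_sub {a b : Fin 2 → ℤ × ℤ → ℂ} (ha : ∀ j, Summable (a j))
    (hb : ∀ j, Summable (b j)) :
    fieldLp L₁ L₂ a - fieldLp L₁ L₂ b = fieldLp L₁ L₂ (fun j k => a j k - b j k) := by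
  rw [fieldLp, fieldLp, fieldLp, fieldOf_sub ha hb, map_sub]

theorem norm_fieldLp_le {a : Fin 2 → ℤ × ℤ → ℂ} (ha : ∀ j, Summable (a j)) :
    ‖fieldLp L₁ L₂ a‖ ≤ ‖(ContinuousMap.toLp 2 volume ℝ : C(Torus L₁ L₂, Plane) →L[ℝ] _)‖ *
      ∑ j, ∑' k, ‖a j k‖ :=
  (ContinuousLinearMap.le_opNorm _ _).trans
    (mul_le_mul_of_nonneg_left (norm_fieldOf_le ha) (norm_nonneg _))

theorem summable_mildCoeff {c : Fin 2 → ℤ × ℤ → ℂ} {G : ℝ → ℤ × ℤ → ℂ} {t M₀ M : ℝ} (ht : 0 < t)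
    (hM : 0 ≤ M) (hc : ∀ j k, ‖c j k‖ ≤ M₀) (hG : ∀ k, ∀ s ∈ Set.Ico 0 t, ‖G s k‖ ≤ M) (j : Fin 2) :
    Summable (mildCoeff L₁ L₂ c G t j) :=
  .of_norm_bounded ((summable_bracket_pow (L₁ := L₁) (L₂ := L₂) le_rfl).mul_left _) fun k =>
    norm_mildCoeff_le (n := 0) ht le_rfl le_rfl hM (hc j k) (by simpa using hG k)

/-- Time zero is excluded because `c` is only bounded: the summable majorant comes from smoothing
and is uniform only on `[t/2, T]`. -/
theorem continuousOn_fieldLp_mildCoeff {c : Fin 2 → ℤ × ℤ → ℂ} {G : ℝ → ℤ × ℤ → ℂ} {T M₀ M : ℝ}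
    (hM : 0 ≤ M) (hc : ∀ j k, ‖c j k‖ ≤ M₀) (hG : ∀ k, ∀ s ∈ Set.Ico 0 T, ‖G s k‖ ≤ M)
    (hi : ∀ k, IntervalIntegrable (fun s => G s k) volume 0 T) :
    ContinuousOn (fun t => fieldLp L₁ L₂ (mildCoeff L₁ L₂ c G t)) (Set.Ioc 0 T) := by
  intro t ht
  have hT : 0 ≤ T := ht.1.le.trans ht.2
  have hmem : Set.Icc (t / 2) T ∈ nhdsWithin t (Set.Ioc 0 T) := by
    refine mem_nhdsWithin.2 ⟨Set.Ioi (t / 2), isOpen_Ioi, half_lt_self ht.1, fun s hs => ?_⟩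
    exact ⟨le_of_lt hs.1, hs.2.2⟩
  refine ContinuousWithinAt.mono_of_mem_nhdsWithin ?_ hmem
  refine continuousOn_fieldLp (fun j k => (continuousOn_mildCoeff c hT (hi k) j).mono
      (Set.Icc_subset_Icc_left (half_pos ht.1).le))
    ((summable_bracket_pow (L₁ := L₁) (L₂ := L₂) le_rfl).mul_left _)
    (fun j k s hs => norm_mildCoeff_le (n := 0) (half_pos ht.1) hs.1 hs.2 hM (hc j k)
      fun r hr => ?_) t ⟨half_le_self ht.1.le, ht.2⟩
  simpa using hG k r ⟨hr.1, hr.2.trans_le hs.2⟩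

/-- Local existence for initial data with absolutely summable Fourier coefficients. -/
theorem exists_local_solution {α : Fin 2 → ℤ × ℤ → ℂ} (hα : ∀ j, Summable (α j)) :
    ∃ τ > 0, ∃ v : ℝ → L2Field L₁ L₂, Continuous v ∧ ∀ t ∈ Set.Icc 0 τ,
      v t = fieldLp L₁ L₂ (mildCoeff L₁ L₂ α (fun s => quad (v s)) t) := by
  set K := ‖(ContinuousMap.toLp 2 volume ℝ : C(Torus L₁ L₂, Plane) →L[ℝ] _)‖ with hK
  set A := (L₁ * L₂)⁻¹ with hA
  have hA0 : 0 < A := inv_pos.2 area_pos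
  have hK0 : 0 ≤ K := norm_nonneg _
  set S := ∑ j, ∑' k, ‖α j k‖ with hS
  have hS0 : 0 ≤ S := Finset.sum_nonneg fun j _ => tsum_nonneg fun k => norm_nonneg _
  -- `K * (exp 1 * S)` bounds the linear evolution of the datum for times at most one; the added `1`
  -- leaves room for the Duhamel term.
  set R := K * (Real.exp 1 * S) + 1 with hR
  have hR1 : 1 ≤ R := by rw [hR]; have : 0 ≤ K * (Real.exp 1 * S) := by positivity
                         linarith
  -- One smallness condition serves both invariance of the ball and contraction: `A * (1 + R² + R²)`
  -- is the Lipschitz constant of the quadratic term on the ball and also dominates its size `A *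
  -- R²`. The factor two counts the components.
  obtain ⟨τ, hτ0, hτ1, hτ⟩ : ∃ τ : ℝ, 0 < τ ∧ τ ≤ 1 ∧
      K * (2 * (A * (1 + R ^ 2 + R ^ 2) * Real.exp 1 * smoothing L₁ L₂ τ)) ≤ 1 / 2 := by
    have h1 := (tendsto_smoothing (L₁ := L₁) (L₂ := L₂)).const_mul
      (A * (1 + R ^ 2 + R ^ 2) * Real.exp 1)
    have h2 := (h1.const_mul 2).const_mul K
    rw [mul_zero, mul_zero, mul_zero] at h2
    have h3 := (h2.eventually_lt_const (show (0 : ℝ) < 1 / 2 by norm_num)).and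
      (Ioc_mem_nhdsGT (show (0 : ℝ) < 1 by norm_num))
    obtain ⟨τ, h4, h5⟩ := h3.exists
    exact ⟨τ, h5.1, h5.2, h4.le⟩
  have hsm := summable_bracket_mul_min (L₁ := L₁) (L₂ := L₂) hτ0.le
  have hexp : Real.exp τ ≤ Real.exp 1 := Real.exp_le_exp.2 hτ1
  have hsm0 : 0 ≤ smoothing L₁ L₂ τ := tsum_nonneg (bracket_mul_min_nonneg hτ0.le)
  -- Constant extension beyond the endpoints makes the forcing continuous on the whole line without
  -- increasing norms.
  let ext (w : C(Set.Icc 0 τ, L2Field L₁ L₂)) : ℝ → L2Field L₁ L₂ := Set.IccExtend hτ0.le w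
  have hext : ∀ w, Continuous (ext w) := fun w => w.continuous.Icc_extend'
  have hext_le : ∀ w s, ‖ext w s‖ ≤ ‖w‖ := fun w s => w.norm_coe_le_norm _
  have hext_sub : ∀ w w' s, ‖ext w s - ext w' s‖ ≤ ‖w - w'‖ := fun w w' s =>
    (w - w').norm_coe_le_norm (Set.projIcc 0 τ hτ0.le s)
  let F (w : C(Set.Icc 0 τ, L2Field L₁ L₂)) : ℝ → ℤ × ℤ → ℂ := fun s => quad (ext w s)
  have hF : ∀ w k, Continuous fun s => F w s k := fun w k =>
    continuousOn_univ.1 (continuousOn_quad (hext w).continuousOn k)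
  have hFle : ∀ w s k, ‖F w s k‖ ≤ A * ‖w‖ ^ 2 := fun w s k => by
    refine (norm_quad_le _ k).trans ?_
    gcongr
    exact hext_le w s
  have hbound : ∀ w j k, ∀ t ∈ Set.Icc 0 τ, ‖mildCoeff L₁ L₂ α (F w) t j k‖ ≤
      Real.exp τ * ‖α j k‖ + A * ‖w‖ ^ 2 * Real.exp τ *
        (bracket L₁ L₂ k * min τ (4 / bracket L₁ L₂ k ^ 4)) := fun w j k t ht =>
    norm_mildCoeff_le_add ht.1 ht.2 (by positivity) fun s _ => hFle w s k
  have hsum0 : ∀ (w : C(Set.Icc 0 τ, L2Field L₁ L₂)) j, Summable fun k => Real.exp τ * ‖α j k‖ + A * ‖w‖ ^ 2 * Real.exp τ *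
        (bracket L₁ L₂ k * min τ (4 / bracket L₁ L₂ k ^ 4)) := fun w j =>
    ((hα j).norm.mul_left _).add (hsm.mul_left _)
  have hsum : ∀ w, ∀ t ∈ Set.Icc 0 τ, ∀ j, Summable (mildCoeff L₁ L₂ α (F w) t j) :=
    fun w t ht j => .of_norm_bounded (hsum0 w j) fun k => hbound w j k t ht
  have hcont : ∀ w, ContinuousOn (fun t => fieldLp L₁ L₂ (mildCoeff L₁ L₂ α (F w) t))
      (Set.Icc 0 τ) := fun w => by
    -- The majorant must not depend on the component, hence the sum of the two.
    refine continuousOn_fieldLp (fun j k => continuousOn_mildCoeff α hτ0.le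
      ((hF w k).intervalIntegrable _ _) j) ((hsum0 w 0).add (hsum0 w 1)) fun j k t ht => ?_
    have hnn : ∀ j, 0 ≤ Real.exp τ * ‖α j k‖ + A * ‖w‖ ^ 2 * Real.exp τ *
        (bracket L₁ L₂ k * min τ (4 / bracket L₁ L₂ k ^ 4)) := fun j =>
      (norm_nonneg _).trans (hbound w j k t ht)
    refine (hbound w j k t ht).trans ?_
    have n0 := hnn 0
    have n1 := hnn 1
    fin_cases j
    · exact le_add_of_nonneg_right n1
    · exact le_add_of_nonneg_left n0
  let Ψ (w : C(Set.Icc 0 τ, L2Field L₁ L₂)) : C(Set.Icc 0 τ, L2Field L₁ L₂) :=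
    ⟨fun t => fieldLp L₁ L₂ (mildCoeff L₁ L₂ α (F w) t),
      continuousOn_iff_continuous_domRestrict.1 (hcont w)⟩
  have hmaps : Set.MapsTo Ψ (Metric.closedBall 0 R) (Metric.closedBall 0 R) := fun w hw => by
    rw [mem_closedBall_zero_iff] at hw ⊢
    refine (ContinuousMap.norm_le _ (zero_le_one.trans hR1)).2 fun t => ?_
    refine (norm_fieldLp_le (hsum w t t.2)).trans ?_
    have h1 : ∑ j, ∑' k, ‖mildCoeff L₁ L₂ α (F w) t j k‖ ≤
        Real.exp 1 * S + 2 * (A * (1 + R ^ 2 + R ^ 2) * Real.exp 1 * smoothing L₁ L₂ τ) := by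
      have h2 : ∀ j, ∑' k, ‖mildCoeff L₁ L₂ α (F w) t j k‖ ≤ Real.exp 1 * ∑' k, ‖α j k‖ +
          A * (1 + R ^ 2 + R ^ 2) * Real.exp 1 * smoothing L₁ L₂ τ := fun j => by
        have h3 := (hsum w t t.2 j).norm.tsum_le_tsum (fun k => hbound w j k t t.2) (hsum0 w j)
        rw [((hα j).norm.mul_left _).tsum_add (hsm.mul_left _), tsum_mul_left, tsum_mul_left] at h3
        refine h3.trans (add_le_add ?_ ?_)
        · gcongr
        · change _ * smoothing L₁ L₂ τ ≤ _
          gcongr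
          have : ‖w‖ ^ 2 ≤ R ^ 2 := by gcongr
          nlinarith [sq_nonneg R]
      refine (Finset.sum_le_sum fun j _ => h2 j).trans_eq ?_
      rw [Finset.sum_add_distrib, ← Finset.mul_sum, hS]
      simp
    calc _ ≤ K * (Real.exp 1 * S +
          2 * (A * (1 + R ^ 2 + R ^ 2) * Real.exp 1 * smoothing L₁ L₂ τ)) := by gcongr
      _ ≤ _ := by rw [mul_add, hR]; linarith
  have hlip : ∀ w ∈ Metric.closedBall 0 R, ∀ w' ∈ Metric.closedBall 0 R,
      dist (Ψ w) (Ψ w') ≤ 1 / 2 * dist w w' := fun w hw w' hw' => by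
    rw [mem_closedBall_zero_iff] at hw hw'
    rw [dist_eq_norm, dist_eq_norm]
    refine (ContinuousMap.norm_le _ (by positivity)).2 fun t => ?_
    change ‖fieldLp L₁ L₂ _ - fieldLp L₁ L₂ _‖ ≤ _
    rw [fieldLp_sub (hsum w t t.2) (hsum w' t t.2)]
    have h0 : ∀ j k, ‖mildCoeff L₁ L₂ α (F w) t j k - mildCoeff L₁ L₂ α (F w') t j k‖ ≤
        A * ((1 + R ^ 2 + R ^ 2) * ‖w - w'‖) * Real.exp 1 *
          (bracket L₁ L₂ k * min τ (4 / bracket L₁ L₂ k ^ 4)) := fun j k => by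
      rw [mildCoeff, mildCoeff, sub_sub_sub_cancel_left, norm_sub_rev,
        duh_sub ((hF w k).intervalIntegrable _ _) ((hF w' k).intervalIntegrable _ _)]
      refine (norm_duh_le (M := A * ((1 + R ^ 2 + R ^ 2) * ‖w - w'‖)) t.2.1 (by positivity)
        (fun s _ => ?_) j).trans ?_
      · refine (norm_quad_sub_le _ _ k).trans ?_
        gcongr
        · exact (hext_le w s).trans hw
        · exact (hext_le w' s).trans hw'
        · exact hext_sub w w' s
      · have hr := bracket_pos (L₁ := L₁) (L₂ := L₂) k
        have := bracket_mul_min_nonneg (L₁ := L₁) (L₂ := L₂) t.2.1 k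
        have h5 : (t : ℝ) ≤ τ := t.2.2
        gcongr
        exact h5.trans hτ1
    have h1 : ∑ j, ∑' k, ‖mildCoeff L₁ L₂ α (F w) t j k - mildCoeff L₁ L₂ α (F w') t j k‖ ≤
        2 * (A * ((1 + R ^ 2 + R ^ 2) * ‖w - w'‖) * Real.exp 1 * smoothing L₁ L₂ τ) := by
      have h2 : ∀ j, ∑' k, ‖mildCoeff L₁ L₂ α (F w) t j k - mildCoeff L₁ L₂ α (F w') t j k‖ ≤
          A * ((1 + R ^ 2 + R ^ 2) * ‖w - w'‖) * Real.exp 1 * smoothing L₁ L₂ τ := fun j => by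
        rw [smoothing, ← tsum_mul_left]
        exact ((hsum w t t.2 j).sub (hsum w' t t.2 j)).norm.tsum_le_tsum (h0 j) (hsm.mul_left _)
      refine (Finset.sum_le_sum fun j _ => h2 j).trans_eq ?_
      simp
    refine (norm_fieldLp_le fun j => (hsum w t t.2 j).sub (hsum w' t t.2 j)).trans ?_
    calc _ ≤ K * (2 * (A * ((1 + R ^ 2 + R ^ 2) * ‖w - w'‖) * Real.exp 1 *
          smoothing L₁ L₂ τ)) := by gcongr
      _ = K * (2 * (A * (1 + R ^ 2 + R ^ 2) * Real.exp 1 * smoothing L₁ L₂ τ)) * ‖w - w'‖ := by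
          ring
      _ ≤ _ := by gcongr
  have hcontr : ContractingWith (1 / 2 : NNReal) (hmaps.restrict Ψ _ _) := by
    refine ⟨by rw [← NNReal.coe_lt_coe]; norm_num, LipschitzWith.of_dist_le_mul fun w w' => ?_⟩
    have h := hlip w w.2 w' w'.2
    rw [NNReal.coe_div, NNReal.coe_one, NNReal.coe_ofNat]
    exact h
  obtain ⟨w, _, hw, _⟩ := hcontr.exists_fixedPoint' Metric.isClosed_closedBall.isComplete hmaps
    (Metric.mem_closedBall_self (zero_le_one.trans hR1)) (edist_ne_top _ _)
  refine ⟨τ, hτ0, ext w, hext w, fun t ht => ?_⟩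
  have h1 : ext w t = w ⟨t, ht⟩ := Set.IccExtend_of_mem hτ0.le w ht
  rw [h1]
  conv_lhs => rw [← hw.eq]
  rfl

/-- The limsup controls a left neighbourhood of `T`; compactness controls the rest. -/
theorem bounded_of_limsup {T : ℝ} {u : ℝ → L2Field L₁ L₂}
    (hu : ContinuousOn u (Set.Ico 0 T))
    (hlim : Filter.limsup (fun t => ‖u t‖ₑ) (nhdsWithin T (Set.Iio T)) < ⊤) :
    ∃ M, 0 ≤ M ∧ ∀ t ∈ Set.Ico 0 T, ‖u t‖ ≤ M := by
  obtain ⟨b, hb1, hb2⟩ := exists_between hlim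
  have h1 := Filter.eventually_lt_of_limsup_lt hb1
  -- Here `l` may be negative. Then `[0, l]` is empty and `C` may be negative too, hence the maximum
  -- with zero below.
  obtain ⟨l, hl, hl'⟩ := (mem_nhdsLT_iff_exists_Ioo_subset (a := T)).1 h1
  obtain ⟨C, hC⟩ := (isCompact_Icc (a := (0 : ℝ)) (b := l)).exists_bound_of_continuousOn
    (hu.mono (Set.Icc_subset_Ico_right hl))
  refine ⟨max (max b.toReal C) 0, le_max_right _ _, fun t ht => ?_⟩
  refine le_trans ?_ (le_max_left _ _)
  rcases le_or_gt t l with h | h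
  · exact (hC t ⟨ht.1, h⟩).trans (le_max_right _ _)
  · refine le_trans ?_ (le_max_left _ _)
    have h3 : ‖u t‖ₑ < b := hl' ⟨h, ht.2⟩
    rw [← toReal_enorm]
    exact ENNReal.toReal_mono hb2.ne h3.le

/-- The extension and its Duhamel integral are compared through a single formula from time zero,
valid on `(0, T + τ]` (`hrep`). It gives the mild equation after `T`, continuity at `T`, and the
agreement at `T` when that point belongs to `J`. -/
theorem exists_extension {u₀ : L2Field L₁ L₂} {T : ℝ} (hT : 0 < T) {J : Set ℝ}
    (hJ : J = Set.Ico 0 T ∨ J = Set.Icc 0 T) {u : ℝ → L2Field L₁ L₂}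
    (hu : IsMildSolution u₀ J u)
    (hlim : Filter.limsup (fun t => ‖u t‖ₑ) (nhdsWithin T (Set.Iio T)) < ⊤) :
    ∃ T' : ℝ, T < T' ∧ ∃ u' : ℝ → L2Field L₁ L₂,
      IsMildSolution u₀ (Set.Icc 0 T') u' ∧ Set.EqOn u' u J := by
  have hJ1 : Set.Ico 0 T ⊆ J := by
    rcases hJ with rfl | rfl
    · exact subset_rfl
    · exact Set.Ico_subset_Icc_self
  have hJ2 : J ⊆ Set.Icc 0 T := by
    rcases hJ with rfl | rfl
    · exact Set.Ico_subset_Icc_self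
    · exact subset_rfl
  have hA0 : 0 < (L₁ * L₂)⁻¹ := inv_pos.2 area_pos
  have huc := hu.continuousOn.mono hJ1
  obtain ⟨M, hM0, hM⟩ := bounded_of_limsup huc hlim
  let c : Fin 2 → ℤ × ℤ → ℂ := fun j k => coeff (fun z => u₀ z j) k
  let G : ℝ → ℤ × ℤ → ℂ := fun s => quad (u s)
  have hcs : ∀ j, IsHermitianSeq (c j) := fun j k => coeff_neg_index _ k
  have hcb : ∀ j k, ‖c j k‖ ≤ (L₁ * L₂)⁻¹ * (L₁ * L₂ + ‖u₀‖ ^ 2) := fun j k =>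
    norm_coeff_component_le u₀ j k
  have hGb : ∀ k, ∀ s ∈ Set.Ico 0 T, ‖G s k‖ ≤ (L₁ * L₂)⁻¹ * M ^ 2 := fun k s hs => by
    refine (norm_quad_le _ k).trans ?_
    gcongr
    exact hM s hs
  have hGi : ∀ k, IntervalIntegrable (fun s => G s k) volume 0 T := fun k => by
    rw [intervalIntegrable_iff_integrableOn_Ico_of_le hT.le]
    refine Integrable.of_bound ((continuousOn_quad huc k).aestronglyMeasurable measurableSet_Ico)
      ((L₁ * L₂)⁻¹ * M ^ 2) ?_
    exact (ae_restrict_iff' measurableSet_Ico).2 (.of_forall (hGb k))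
  -- The datum at `T` is the value of the Duhamel formula there, not `u T`, which carries no
  -- information when `J` is half-open.
  obtain ⟨τ, hτ, v, hv, hvτ⟩ := exists_local_solution (L₁ := L₁) (L₂ := L₂)
    (α := mildCoeff L₁ L₂ c G T) (summable_mildCoeff hT (by positivity) hcb hGb)
  let u' : ℝ → L2Field L₁ L₂ := fun t => if t < T then u t else v (t - T)
  have hu'1 : ∀ t < T, u' t = u t := fun t ht => if_pos ht
  have hu'2 : ∀ t, 0 ≤ t → u' (T + t) = v t := fun t ht => by
    simp only [u']
    rw [if_neg (by linarith), add_sub_cancel_left]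
  let G' : ℝ → ℤ × ℤ → ℂ := fun s => quad (u' s)
  have hG'1 : ∀ k, ∀ s ∈ Set.Ico 0 T, G s k = G' s k := fun k s hs => by
    simp only [G, G', hu'1 s hs.2]
  have hcoef : ∀ t ∈ Set.Icc 0 T, ∀ j k,
      mildCoeff L₁ L₂ c G t j k = mildCoeff L₁ L₂ c G' t j k := fun t ht j k => by
    rw [mildCoeff, mildCoeff, duh_congr ht.1 fun s hs => hG'1 k s ⟨hs.1, hs.2.trans_le ht.2⟩]
  have hG'i1 : ∀ k, IntervalIntegrable (fun s => G' s k) volume 0 T := fun k => by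
    rw [intervalIntegrable_iff_integrableOn_Ico_of_le hT.le]
    refine IntegrableOn.congr_fun ?_ (hG'1 k) measurableSet_Ico
    exact (intervalIntegrable_iff_integrableOn_Ico_of_le hT.le).1 (hGi k)
  have hG'2 : ∀ k s, 0 ≤ s → G' (T + s) k = quad (v s) k := fun k s hs => by
    simp only [G', hu'2 s hs]
  have hG'i2 : ∀ k t, 0 ≤ t → IntervalIntegrable (fun s => G' s k) volume T (T + t) :=
    fun k t ht => by
    have hc : Continuous fun s => quad (v (s - T)) k := continuousOn_univ.1
      (continuousOn_quad (u := fun s => v (s - T)) (by fun_prop) k)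
    refine (hc.intervalIntegrable T (T + t)).congr fun s hs => ?_
    rw [Set.uIoc_of_le (by linarith)] at hs
    have := hG'2 k (s - T) (by linarith [hs.1])
    rw [add_sub_cancel] at this
    exact this.symm
  have hG'i : ∀ k, IntervalIntegrable (fun s => G' s k) volume 0 (T + τ) := fun k =>
    (hG'i1 k).trans (hG'i2 k τ hτ.le)
  obtain ⟨C, hC⟩ := (isCompact_Icc (a := (0 : ℝ)) (b := τ)).exists_bound_of_continuousOn
    hv.continuousOn
  have hC0 : 0 ≤ C := (norm_nonneg _).trans (hC 0 ⟨le_rfl, hτ.le⟩)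
  have hu'b : ∀ s ∈ Set.Icc 0 (T + τ), ‖u' s‖ ≤ max M C := fun s hs => by
    rcases lt_or_ge s T with h | h
    · rw [hu'1 s h]
      exact (hM s ⟨hs.1, h⟩).trans (le_max_left _ _)
    · have := hu'2 (s - T) (by linarith)
      rw [add_sub_cancel] at this
      rw [this]
      exact (hC _ ⟨by linarith, by linarith [hs.2]⟩).trans (le_max_right _ _)
  have hG'b : ∀ k, ∀ s ∈ Set.Ico 0 (T + τ), ‖G' s k‖ ≤ (L₁ * L₂)⁻¹ * (max M C) ^ 2 :=
    fun k s hs => by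
    refine (norm_quad_le _ k).trans ?_
    gcongr
    exact hu'b s (Set.Ico_subset_Icc_self hs)
  have hsum : ∀ t ∈ Set.Ioc 0 (T + τ), ∀ j, Summable (mildCoeff L₁ L₂ c G' t j) := fun t ht =>
    summable_mildCoeff ht.1 (by positivity) hcb fun k s hs => hG'b k s ⟨hs.1, hs.2.trans_le ht.2⟩
  have hsym : ∀ t j, IsHermitianSeq (mildCoeff L₁ L₂ c G' t j) := fun t j =>
    isHermitianSeq_mildCoeff hcs (fun s => isHermitianSeq_quad _) t j
  have hdu : ∀ t ∈ J, ∀ j k, coeff (fun z => u t z j) k = mildCoeff L₁ L₂ c G' t j k :=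
    fun t ht j k => (hu.duhamel t ht j k).trans (hcoef t (hJ2 ht) j k)
  have hrep1 : ∀ t ∈ J, 0 < t → u t = fieldLp L₁ L₂ (mildCoeff L₁ L₂ c G' t) :=
    fun t ht ht0 => eq_fieldLp (hsum t ⟨ht0, by linarith [(hJ2 ht).2]⟩) (hsym t) (hdu t ht)
  have hrep2 : ∀ t ∈ Set.Icc 0 τ, v t = fieldLp L₁ L₂ (mildCoeff L₁ L₂ c G' (T + t)) :=
    fun t ht => by
    rw [hvτ t ht]
    congr 1
    ext j k
    -- The formula for `v` with datum at `T` is the restarted formula for the glued forcing.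
    rw [mildCoeff_add (hG'i1 k) (hG'i2 k t ht.1)]
    change _ * mildCoeff L₁ L₂ c G T j k - _ = _ * mildCoeff L₁ L₂ c G' T j k - _
    rw [hcoef T ⟨hT.le, le_rfl⟩ j k, duh_congr ht.1 fun s hs => (hG'2 k s hs.1).symm]
  have hrep : ∀ t ∈ Set.Ioc 0 (T + τ), u' t = fieldLp L₁ L₂ (mildCoeff L₁ L₂ c G' t) :=
    fun t ht => by
    rcases lt_or_ge t T with h | h
    · rw [hu'1 t h, hrep1 t (hJ1 ⟨ht.1.le, h⟩) ht.1]
    · have := hu'2 (t - T) (by linarith)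
      rw [add_sub_cancel] at this
      rw [this, hrep2 _ ⟨by linarith, by linarith [ht.2]⟩, add_sub_cancel]
  refine ⟨T + τ, by linarith, u', ⟨?_, ?_⟩, ?_⟩
  · intro t ht
    -- At time zero the datum is merely in `L²` and the series representation is not available;
    -- continuity there is inherited from `u`.
    rcases eq_or_lt_of_le ht.1 with h | h
    · have hw : ContinuousWithinAt u' (Set.Ico 0 T) t :=
        (huc t ⟨ht.1, by linarith⟩).congr (fun s hs => hu'1 s hs.2) (hu'1 t (by linarith))
      refine hw.mono_of_mem_nhdsWithin ?_
      exact mem_nhdsWithin.2 ⟨Set.Iio T, isOpen_Iio, by rw [← h]; exact hT,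
        fun s hs => ⟨hs.2.1, hs.1⟩⟩
    · have hw : ContinuousWithinAt u' (Set.Ioc 0 (T + τ)) t :=
        ((continuousOn_fieldLp_mildCoeff (by positivity) hcb hG'b hG'i).congr hrep) t ⟨h, ht.2⟩
      refine hw.mono_of_mem_nhdsWithin ?_
      exact mem_nhdsWithin.2 ⟨Set.Ioi 0, isOpen_Ioi, h, fun s hs => ⟨hs.1, hs.2.2⟩⟩
  · intro t ht j k
    rcases lt_or_ge t T with h | h
    · rw [hu'1 t h]
      exact hdu t (hJ1 ⟨ht.1, h⟩) j k
    · have ht' : t ∈ Set.Ioc 0 (T + τ) := ⟨hT.trans_le h, ht.2⟩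
      rw [hrep t ht', coeff_fieldLp (hsum t ht') (hsym t)]
      rfl
  · intro t ht
    rcases lt_or_ge t T with h | h
    · exact hu'1 t h
    · have := (hJ2 ht).2
      rw [hrep1 t ht (hT.trans_le h), hrep t ⟨hT.trans_le h, by linarith⟩]

end Existence

/-! ### Bootstrap: rapid decay of the coefficients at positive times. -/

section Decay

variable {L₁ L₂ : ℝ} [Fact (0 < L₁)] [Fact (0 < L₂)]

/-- The Fourier coefficients of the components of a field. -/
def fieldCoeff (f : L2Field L₁ L₂) (j : Fin 2) (k : ℤ × ℤ) : ℂ := coeff (fun z => f z j) k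

theorem isHermitianSeq_fieldCoeff (f : L2Field L₁ L₂) (j : Fin 2) :
    IsHermitianSeq (fieldCoeff f j) := fun k => coeff_neg_index _ k

variable {u₀ : L2Field L₁ L₂} {T : ℝ} {u : ℝ → L2Field L₁ L₂}

theorem IsMildSolution.fieldCoeff_eq {J : Set ℝ} (hu : IsMildSolution u₀ J u) {t : ℝ} (ht : t ∈ J)
    (j : Fin 2) (k : ℤ × ℤ) : fieldCoeff (u t) j k =
      mildCoeff L₁ L₂ (fieldCoeff u₀) (fun s => quad (u s)) t j k :=
  hu.duhamel t ht j k

theorem IsMildSolution.exists_norm_quad_le (hu : IsMildSolution u₀ (Set.Icc 0 T) u) :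
    ∃ M, 0 ≤ M ∧ ∀ k, ∀ s ∈ Set.Icc 0 T, ‖quad (u s) k‖ ≤ M := by
  obtain ⟨C, hC⟩ := isCompact_Icc.exists_bound_of_continuousOn hu.continuousOn
  have hA0 : 0 < (L₁ * L₂)⁻¹ := inv_pos.2 area_pos
  refine ⟨(L₁ * L₂)⁻¹ * C ^ 2, by positivity, fun k s hs => (norm_quad_le _ k).trans ?_⟩
  gcongr
  exact hC s hs

theorem IsMildSolution.intervalIntegrable_quad (hu : IsMildSolution u₀ (Set.Icc 0 T) u) {a b : ℝ}
    (ha : 0 ≤ a) (hab : a ≤ b) (hb : b ≤ T) (k : ℤ × ℤ) :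
    IntervalIntegrable (fun s => quad (u s) k) volume a b := by
  refine ((continuousOn_quad hu.continuousOn k).mono ?_).intervalIntegrable
  rw [Set.uIcc_of_le hab]
  exact Set.Icc_subset_Icc ha hb

theorem IsMildSolution.summable_fieldCoeff (hu : IsMildSolution u₀ (Set.Icc 0 T) u) {t : ℝ}
    (ht : t ∈ Set.Ioc 0 T) (j : Fin 2) : Summable (fieldCoeff (u t) j) := by
  obtain ⟨M, hM0, hM⟩ := hu.exists_norm_quad_le
  have h := summable_mildCoeff (L₁ := L₁) (L₂ := L₂) ht.1 hM0 (norm_coeff_component_le u₀)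
    (fun k s hs => hM k s ⟨hs.1, hs.2.le.trans ht.2⟩) j
  exact h.congr fun k => (hu.fieldCoeff_eq ⟨ht.1.le, ht.2⟩ j k).symm

theorem IsMildSolution.eq_fieldLp (hu : IsMildSolution u₀ (Set.Icc 0 T) u) {t : ℝ}
    (ht : t ∈ Set.Ioc 0 T) : u t = fieldLp L₁ L₂ (fieldCoeff (u t)) :=
  KS2D.eq_fieldLp (hu.summable_fieldCoeff ht) (isHermitianSeq_fieldCoeff _) fun _ _ => rfl

theorem IsMildSolution.quad_eq (hu : IsMildSolution u₀ (Set.Icc 0 T) u) {t : ℝ}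
    (ht : t ∈ Set.Ioc 0 T) (k : ℤ × ℤ) : quad (u t) k =
      (conv (fieldCoeff (u t) 0) (fieldCoeff (u t) 0) k +
        conv (fieldCoeff (u t) 1) (fieldCoeff (u t) 1) k) / 2 := by
  conv_lhs => rw [hu.eq_fieldLp ht]
  exact quad_fieldLp (hu.summable_fieldCoeff ht) (isHermitianSeq_fieldCoeff _) k

theorem IsMildSolution.exists_norm_quad_le_of_decay (hu : IsMildSolution u₀ (Set.Icc 0 T) u)
    {ε C : ℝ} (hε : 0 < ε) (hC0 : 0 ≤ C) {n : ℕ} (hn : 3 ≤ n)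
    (hC : ∀ t ∈ Set.Icc ε T, ∀ j k, ‖fieldCoeff (u t) j k‖ ≤ C * (bracket L₁ L₂ k ^ n)⁻¹) :
    ∃ M, 0 ≤ M ∧ ∀ t ∈ Set.Icc ε T, ∀ k, ‖quad (u t) k‖ ≤ M * (bracket L₁ L₂ k ^ n)⁻¹ := by
  have hS : 0 ≤ ∑' l, (bracket L₁ L₂ l ^ n)⁻¹ :=
    tsum_nonneg fun l => inv_nonneg.2 (pow_nonneg (bracket_pos l).le _)
  refine ⟨C * C * 2 ^ (n + 1) * (∑' l, (bracket L₁ L₂ l ^ n)⁻¹), by positivity,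
    fun t ht k => ?_⟩
  have h := fun j => norm_conv_le hn hC0 hC0 (hC t ht j) (hC t ht j) k
  rw [hu.quad_eq ⟨hε.trans_le ht.1, ht.2⟩, norm_div, Complex.norm_ofNat]
  have := (norm_add_le _ _).trans (add_le_add (h 0) (h 1))
  linarith

/-- Bootstrap: the coefficients of a mild solution decay faster than any power,
locally uniformly for positive times. -/
theorem IsMildSolution.exists_decay (hu : IsMildSolution u₀ (Set.Icc 0 T) u) (m : ℕ) {ε : ℝ}
    (hε : 0 < ε) : ∃ C, 0 ≤ C ∧ ∀ t ∈ Set.Icc ε T, ∀ j k,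
      ‖fieldCoeff (u t) j k‖ ≤ C * (bracket L₁ L₂ k ^ (3 * m + 3))⁻¹ := by
  have hT : 0 < L₁ * L₂ := area_pos
  induction m generalizing ε with
  | zero =>
    obtain ⟨M, hM0, hM⟩ := hu.exists_norm_quad_le
    refine ⟨Real.exp T * ((0 + 3).factorial * (4 / ε) ^ (0 + 3) *
      ((L₁ * L₂)⁻¹ * (L₁ * L₂ + ‖u₀‖ ^ 2)) + 4 * M), by positivity, fun t ht j k => ?_⟩
    rw [hu.fieldCoeff_eq ⟨hε.le.trans ht.1, ht.2⟩]
    refine norm_mildCoeff_le hε ht.1 ht.2 hM0 (norm_coeff_component_le u₀ j k) fun s hs => ?_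
    simpa using hM k s ⟨hs.1, hs.2.le.trans ht.2⟩
  | succ m ih =>
    -- The induction hypothesis is used from time `ε/2`; restarting there leaves at least `ε/2` for
    -- the semigroup to smooth the new datum, which therefore need only be bounded.
    obtain ⟨C, hC0, hC⟩ := ih (half_pos hε)
    obtain ⟨M, hM0, hM⟩ := hu.exists_norm_quad_le_of_decay (half_pos hε) hC0
      (show 3 ≤ 3 * m + 3 by omega) hC
    refine ⟨Real.exp T * ((3 * m + 3 + 3).factorial * (4 / (ε / 2)) ^ (3 * m + 3 + 3) * C +
      4 * M), by positivity, fun t ht j k => ?_⟩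
    have ht' : t = ε / 2 + (t - ε / 2) := by ring
    have hεt : ε / 2 ≤ T := by linarith [ht.1, ht.2]
    rw [hu.fieldCoeff_eq ⟨hε.le.trans ht.1, ht.2⟩, ht', mildCoeff_add
      (hu.intervalIntegrable_quad le_rfl (half_pos hε).le hεt k)
      (hu.intervalIntegrable_quad (half_pos hε).le (by linarith [ht.1]) (by linarith [ht.2]) k)]
    refine norm_mildCoeff_le (half_pos hε) (by linarith [ht.1]) (by linarith [ht.2]) hM0 ?_
      fun s hs => hM _ ⟨by linarith [hs.1], by linarith [hs.2, ht.2]⟩ k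
    rw [← hu.fieldCoeff_eq ⟨(half_pos hε).le, hεt⟩]
    refine (hC _ ⟨le_rfl, hεt⟩ j k).trans (mul_le_of_le_one_right hC0 ?_)
    exact inv_le_one_of_one_le₀ (one_le_pow₀ (one_le_bracket k))

theorem IsMildSolution.continuousOn_fieldCoeff (hu : IsMildSolution u₀ (Set.Icc 0 T) u)
    (hT : 0 ≤ T) (j : Fin 2) (k : ℤ × ℤ) :
    ContinuousOn (fun t => fieldCoeff (u t) j k) (Set.Icc 0 T) :=
  (continuousOn_mildCoeff _ hT (hu.intervalIntegrable_quad le_rfl hT le_rfl k) j).congr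
    fun _ ht => hu.fieldCoeff_eq ht j k

theorem IsMildSolution.hasDerivAt_fieldCoeff (hu : IsMildSolution u₀ (Set.Icc 0 T) u) {t : ℝ}
    (ht : t ∈ Set.Ioo 0 T) (j : Fin 2) (k : ℤ × ℤ) :
    HasDerivAt (fun t => fieldCoeff (u t) j k)
      (-(symb L₁ L₂ k : ℂ) * fieldCoeff (u t) j k
        - Complex.I * (freq L₁ L₂ k j : ℂ) * quad (u t) k) t := by
  rw [hu.fieldCoeff_eq (Set.Ioo_subset_Icc_self ht)]
  refine (hasDerivAt_mildCoeff _ (continuousOn_quad hu.continuousOn k) ht j).congr_of_eventuallyEq ?_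
  filter_upwards [Ioo_mem_nhds ht.1 ht.2] with s hs
  exact hu.fieldCoeff_eq (Set.Ioo_subset_Icc_self hs) j k

/-- Multiplied by the opposite frequencies, the two Duhamel terms coincide because the forcing is a
gradient; the linear evolution multiplies the condition on the datum by `e^{-tσ}`. -/
theorem IsMildSolution.curlFree (hu : IsMildSolution u₀ (Set.Icc 0 T) u) (h₀ : IsCurlFree u₀)
    {t : ℝ} (ht : t ∈ Set.Icc 0 T) : IsCurlFree (u t) := fun k => by
  have h := h₀ k
  change _ * fieldCoeff u₀ 0 k = _ * fieldCoeff u₀ 1 k at h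
  change _ * fieldCoeff (u t) 0 k = _ * fieldCoeff (u t) 1 k
  rw [hu.fieldCoeff_eq ht, hu.fieldCoeff_eq ht]
  simp only [mildCoeff, duh]
  linear_combination (Real.exp (-t * symb L₁ L₂ k) : ℂ) * h

end Decay

/-! ### Termwise differentiation of Fourier series in space and time. -/

section Differentiation

variable {L₁ L₂ : ℝ}

variable (L₁ L₂) in
/-- The linear form `p ↦ κ · p`, `κ = freq k`. -/
def phase (k : ℤ × ℤ) : Plane →L[ℝ] ℝ :=
  freq L₁ L₂ k 0 • EuclideanSpace.proj 0 + freq L₁ L₂ k 1 • EuclideanSpace.proj 1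

theorem phase_apply (k : ℤ × ℤ) (p : Plane) :
    phase L₁ L₂ k p = freq L₁ L₂ k 0 * p 0 + freq L₁ L₂ k 1 * p 1 := by
  simp [phase]

theorem phase_single (k : ℤ × ℤ) (j : Fin 2) :
    phase L₁ L₂ k (EuclideanSpace.single j 1) = freq L₁ L₂ k j := by
  rw [phase_apply]
  fin_cases j <;> simp

theorem norm_phase_le (k : ℤ × ℤ) : ‖phase L₁ L₂ k‖ ≤ bracket L₁ L₂ k := by
  refine ContinuousLinearMap.opNorm_le_bound _ (bracket_pos k).le fun p => ?_
  rw [phase_apply, Real.norm_eq_abs]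
  refine abs_le_of_sq_le_sq ?_ (mul_nonneg (bracket_pos k).le (norm_nonneg p))
  rw [mul_pow, bracket_sq, EuclideanSpace.norm_sq_eq, Fin.sum_univ_two, Real.norm_eq_abs,
    Real.norm_eq_abs, sq_abs, sq_abs]
  nlinarith [sq_nonneg (freq L₁ L₂ k 0 * p 1 - freq L₁ L₂ k 1 * p 0), sq_nonneg (p 0),
    sq_nonneg (p 1)]

variable (L₁ L₂) in
/-- The projection of the plane to the torus. -/
def toTorus (p : Plane) : Torus L₁ L₂ := ((p 0 : AddCircle L₁), (p 1 : AddCircle L₂))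

theorem continuous_toTorus : Continuous (toTorus L₁ L₂) := by
  unfold toTorus
  refine Continuous.prodMk ?_ ?_
  · exact (AddCircle.continuous_mk' L₁).comp (EuclideanSpace.proj (𝕜 := ℝ) (0 : Fin 2)).continuous
  · exact (AddCircle.continuous_mk' L₂).comp (EuclideanSpace.proj (𝕜 := ℝ) (1 : Fin 2)).continuous

theorem expo_toTorus (k : ℤ × ℤ) (p : Plane) :
    expo k (toTorus L₁ L₂ p) = Complex.exp (phase L₁ L₂ k p * Complex.I) := by
  rw [expo_apply, toTorus, fourier_coe_apply, fourier_coe_apply, ← Complex.exp_add, phase_apply]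
  congr 1
  simp only [freq, Matrix.cons_val_zero, Matrix.cons_val_one]
  push_cast
  ring

theorem iteratedDeriv_exp_mul_I (n : ℕ) :
    iteratedDeriv n (fun x : ℝ => Complex.exp (x * Complex.I)) =
      fun x : ℝ => Complex.I ^ n * Complex.exp (x * Complex.I) := by
  induction n with
  | zero => simp
  | succ n ih =>
    rw [iteratedDeriv_succ, ih]
    ext x
    have h : HasDerivAt (fun x : ℝ => Complex.exp (x * Complex.I))
        (Complex.exp (x * Complex.I) * (1 * Complex.I)) x :=
      ((Complex.ofRealCLM.hasDerivAt (x := x)).mul_const Complex.I).cexp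
    rw [(h.const_mul _).deriv, pow_succ]
    ring

theorem contDiff_exp_mul_I {n : WithTop ℕ∞} :
    ContDiff ℝ n fun x : ℝ => Complex.exp (x * Complex.I) :=
  (Complex.ofRealCLM.contDiff.mul contDiff_const).cexp

theorem contDiff_expo (k : ℤ × ℤ) {n : WithTop ℕ∞} :
    ContDiff ℝ n fun p => expo k (toTorus L₁ L₂ p) := by
  simp only [expo_toTorus]
  exact contDiff_exp_mul_I.comp (phase L₁ L₂ k).contDiff

/-- A plane wave is `x ↦ e^{ix}` composed with the linear form `phase`, so each derivative costs a
factor at most `⟨k⟩`. -/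
theorem norm_iteratedFDeriv_expo_le (k : ℤ × ℤ) (i : ℕ) (p : Plane) :
    ‖iteratedFDeriv ℝ i (fun p => expo k (toTorus L₁ L₂ p)) p‖ ≤ bracket L₁ L₂ k ^ i := by
  have e : (fun p => (expo k (toTorus L₁ L₂ p) : ℂ)) =
      (fun x : ℝ => Complex.exp (x * Complex.I)) ∘ phase L₁ L₂ k := by
    ext p; exact expo_toTorus k p
  rw [e, (phase L₁ L₂ k).iteratedFDeriv_comp_right (contDiff_exp_mul_I (n := i)) p le_rfl]
  refine (ContinuousMultilinearMap.norm_compContinuousLinearMap_le _ _).trans ?_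
  rw [norm_iteratedFDeriv_eq_norm_iteratedDeriv, iteratedDeriv_exp_mul_I]
  simp only [norm_mul, norm_pow, Complex.norm_I, one_pow, Complex.norm_exp_ofReal_mul_I, one_mul,
    Finset.prod_const, Finset.card_univ, Fintype.card_fin]
  exact pow_le_pow_left₀ (norm_nonneg _) (norm_phase_le k) i

theorem summable_of_bracket {b : ℤ × ℤ → ℂ} {n : ℕ}
    (hb : Summable fun k => bracket L₁ L₂ k ^ n * ‖b k‖) : Summable b :=
  .of_norm_bounded hb fun k =>
    le_mul_of_one_le_left (norm_nonneg _) (one_le_pow₀ (one_le_bracket k))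

theorem iteratedFDeriv_mul_expo (c : ℂ) (k : ℤ × ℤ) (i : ℕ) (p : Plane) :
    iteratedFDeriv ℝ i (fun p => c * expo k (toTorus L₁ L₂ p)) p =
      c • iteratedFDeriv ℝ i (fun p => expo k (toTorus L₁ L₂ p)) p :=
  iteratedFDeriv_const_smul_apply (a := c) (contDiff_expo k).contDiffAt

theorem norm_iteratedFDeriv_mul_expo_le {i n : ℕ} (hi : i ≤ n) (c : ℂ) (k : ℤ × ℤ) (p : Plane) :
    ‖iteratedFDeriv ℝ i (fun p => c * expo k (toTorus L₁ L₂ p)) p‖ ≤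
      bracket L₁ L₂ k ^ n * ‖c‖ := by
  rw [iteratedFDeriv_mul_expo, norm_smul, mul_comm]
  gcongr
  exact (norm_iteratedFDeriv_expo_le k i p).trans (pow_le_pow_right₀ (one_le_bracket k) hi)

theorem summable_freq_mul {b : ℤ × ℤ → ℂ} {n : ℕ}
    (hb : Summable fun k => bracket L₁ L₂ k ^ (n + 1) * ‖b k‖) (j : Fin 2) :
    Summable fun k => bracket L₁ L₂ k ^ n * ‖Complex.I * (freq L₁ L₂ k j : ℂ) * b k‖ := by
  refine .of_nonneg_of_le
    (fun k => mul_nonneg (pow_nonneg (bracket_pos k).le _) (norm_nonneg _)) (fun k => ?_) hb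
  have hr := bracket_pos (L₁ := L₁) (L₂ := L₂) k
  rw [norm_mul, norm_mul, Complex.norm_I, one_mul, Complex.norm_real, Real.norm_eq_abs, pow_succ,
    mul_assoc]
  gcongr
  exact abs_freq_le k j

theorem laplacian_eq_sum_pderiv {f : Plane → ℝ} (hf : ContDiff ℝ 2 f) :
    Laplacian.laplacian f = fun p => ∑ j, pderiv j (pderiv j f) p := by
  rw [InnerProductSpace.laplacian_eq_iteratedFDeriv_orthonormalBasis f
    (EuclideanSpace.basisFun (Fin 2) ℝ)]
  ext p
  refine Finset.sum_congr rfl fun j _ => ?_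
  have hd : DifferentiableAt ℝ (fderiv ℝ f) p :=
    ((hf.fderiv_right (m := 1) (by norm_num)).differentiable (by norm_num)) p
  rw [iteratedFDeriv_two_apply]
  change _ = fderiv ℝ (fun q => fderiv ℝ f q (EuclideanSpace.single j 1)) p _
  rw [fderiv_clm_apply hd (differentiableAt_const _)]
  simp

variable [Fact (0 < L₁)] [Fact (0 < L₂)]

theorem fourierSeries_toTorus {b : ℤ × ℤ → ℂ} (hb : Summable b) :
    (fun p => fourierSeries L₁ L₂ b (toTorus L₁ L₂ p)) =
      fun p => ∑' k, b k * expo k (toTorus L₁ L₂ p) := by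
  ext p; exact fourierSeries_apply hb _

theorem contDiff_fourierSeries {b : ℤ × ℤ → ℂ} {n : ℕ}
    (hb : Summable fun k => bracket L₁ L₂ k ^ n * ‖b k‖) :
    ContDiff ℝ n fun p => fourierSeries L₁ L₂ b (toTorus L₁ L₂ p) := by
  rw [fourierSeries_toTorus (summable_of_bracket hb)]
  exact contDiff_tsum (N := n) (v := fun _ k => bracket L₁ L₂ k ^ n * ‖b k‖)
    (fun k => contDiff_const.mul (contDiff_expo k)) (fun _ _ => hb)
    fun i k p hi => norm_iteratedFDeriv_mul_expo_le (by exact_mod_cast hi) (b k) k p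

/-- The differentiated series has jointly continuous terms and a majorant uniform in time and space.
-/
theorem continuousOn_iteratedFDeriv_fourierSeries {b : ℝ → ℤ × ℤ → ℂ} {s : Set ℝ}
    {B : ℤ × ℤ → ℝ} {i n : ℕ} (hi : i ≤ n) (hc : ∀ k, ContinuousOn (fun t => b t k) s)
    (hB : Summable fun k => bracket L₁ L₂ k ^ n * B k) (hb : ∀ k, ∀ t ∈ s, ‖b t k‖ ≤ B k) :
    ContinuousOn (fun q : ℝ × Plane => iteratedFDeriv ℝ i
      (fun p => fourierSeries L₁ L₂ (b q.1) (toTorus L₁ L₂ p)) q.2) (s ×ˢ Set.univ) := by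
  have hle : ∀ k, ∀ t ∈ s, bracket L₁ L₂ k ^ n * ‖b t k‖ ≤ bracket L₁ L₂ k ^ n * B k :=
    fun k t ht => mul_le_mul_of_nonneg_left (hb k t ht) (pow_nonneg (bracket_pos k).le _)
  have hs : ∀ t ∈ s, Summable fun k => bracket L₁ L₂ k ^ n * ‖b t k‖ := fun t ht =>
    .of_nonneg_of_le (fun k => mul_nonneg (pow_nonneg (bracket_pos k).le _) (norm_nonneg _))
      (fun k => hle k t ht) hB
  have hsum : ContinuousOn (fun q : ℝ × Plane => ∑' k, iteratedFDeriv ℝ i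
      (fun p => b q.1 k * expo k (toTorus L₁ L₂ p)) q.2) (s ×ˢ Set.univ) := by
    refine continuousOn_tsum (fun k => ?_) hB fun k q hq =>
      (norm_iteratedFDeriv_mul_expo_le hi _ k q.2).trans (hle k q.1 hq.1)
    simp only [iteratedFDeriv_mul_expo]
    refine ((hc k).comp continuousOn_fst fun q hq => hq.1).smul ?_
    exact (((contDiff_expo (n := i) k).continuous_iteratedFDeriv le_rfl).comp
      continuous_snd).continuousOn
  refine hsum.congr fun q hq => ?_
  dsimp only
  rw [fourierSeries_toTorus (summable_of_bracket (hs q.1 hq.1))]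
  exact iteratedFDeriv_tsum_apply (N := n) (v := fun _ k => bracket L₁ L₂ k ^ n * ‖b q.1 k‖)
    (fun k => contDiff_const.mul (contDiff_expo k)) (fun _ _ => hs q.1 hq.1)
    (fun i k p hi => norm_iteratedFDeriv_mul_expo_le (by exact_mod_cast hi) _ k p)
    (by exact_mod_cast hi) q.2

/-- Termwise partial differentiation. -/
theorem pderiv_fourierSeries {b : ℤ × ℤ → ℂ} (hb : Summable fun k => bracket L₁ L₂ k ^ 1 * ‖b k‖)
    (j : Fin 2) : pderiv j (fun p => (fourierSeries L₁ L₂ b (toTorus L₁ L₂ p)).re) = fun p =>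
      (fourierSeries L₁ L₂ (fun k => Complex.I * (freq L₁ L₂ k j : ℂ) * b k)
        (toTorus L₁ L₂ p)).re := by
  ext p
  have hb' := summable_of_bracket (n := 0) (summable_freq_mul hb j)
  let f' : ℤ × ℤ → Plane → Plane →L[ℝ] ℂ := fun k p =>
    (phase L₁ L₂ k).smulRight (b k * (expo k (toTorus L₁ L₂ p) * Complex.I))
  have hf : ∀ k p, HasFDerivAt (fun p => b k * expo k (toTorus L₁ L₂ p)) (f' k p) p :=
    fun k p => by
    simp only [f', expo_toTorus]
    have h1 := (Complex.ofRealCLM.hasFDerivAt.comp p (phase L₁ L₂ k).hasFDerivAt).mul_const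
      Complex.I
    have h2 := h1.cexp.const_mul (b k)
    refine h2.congr_fderiv ?_
    ext q
    simp
    ring
  have hle : ∀ k p, ‖f' k p‖ ≤ bracket L₁ L₂ k ^ 1 * ‖b k‖ := fun k p => by
    simp only [f', ContinuousLinearMap.norm_smulRight_apply, norm_mul, norm_expo_apply,
      Complex.norm_I, mul_one, pow_one]
    gcongr
    exact norm_phase_le k
  have hs : Summable fun k => f' k p := .of_norm_bounded hb fun k => hle k p
  have hd := hasFDerivAt_tsum hb hf hle (summable_mul_expo (summable_of_bracket hb) _) p
    (x₀ := 0)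
  rw [← fourierSeries_toTorus (summable_of_bracket hb)] at hd
  have hre := Complex.reCLM.hasFDerivAt.comp p hd
  have : pderiv j (fun p => (fourierSeries L₁ L₂ b (toTorus L₁ L₂ p)).re) p =
      ((∑' k, f' k p) (EuclideanSpace.single j 1)).re :=
    congrArg (fun D : Plane →L[ℝ] ℝ => D (EuclideanSpace.single j 1)) hre.fderiv
  rw [this, fourierSeries_apply hb']
  have h := (ContinuousLinearMap.apply ℝ ℂ (EuclideanSpace.single j (1 : ℝ) : Plane)).map_tsum hs
  simp only [ContinuousLinearMap.apply_apply] at h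
  rw [h]
  congr 2; ext k
  simp only [f', ContinuousLinearMap.smulRight_apply, phase_single, Complex.real_smul]
  ring

theorem laplacian_fourierSeries {b : ℤ × ℤ → ℂ}
    (hb : Summable fun k => bracket L₁ L₂ k ^ 2 * ‖b k‖) :
    Laplacian.laplacian (fun p => (fourierSeries L₁ L₂ b (toTorus L₁ L₂ p)).re) = fun p =>
      (fourierSeries L₁ L₂
        (fun k => -((freq L₁ L₂ k 0 ^ 2 + freq L₁ L₂ k 1 ^ 2 : ℝ) : ℂ) * b k)
        (toTorus L₁ L₂ p)).re := by
  have h1 : Summable fun k => bracket L₁ L₂ k ^ 1 * ‖b k‖ := by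
    refine .of_nonneg_of_le
      (fun k => mul_nonneg (pow_nonneg (bracket_pos k).le _) (norm_nonneg _)) (fun k => ?_) hb
    gcongr
    · exact one_le_bracket k
    · norm_num
  have hc : ContDiff ℝ 2 fun p => (fourierSeries L₁ L₂ b (toTorus L₁ L₂ p)).re :=
    Complex.reCLM.contDiff.comp (contDiff_fourierSeries hb)
  have hj := fun j => summable_of_bracket (n := 0) (summable_freq_mul (n := 0)
    (summable_freq_mul hb j) j)
  rw [laplacian_eq_sum_pderiv hc]
  ext p
  simp only [pderiv_fourierSeries h1, pderiv_fourierSeries (summable_freq_mul hb _),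
    Fin.sum_univ_two]
  rw [← Complex.add_re, fourierSeries_apply (hj 0), fourierSeries_apply (hj 1),
    ← (summable_mul_expo (hj 0) _).tsum_add (summable_mul_expo (hj 1) _)]
  have e : ∀ k, (-((freq L₁ L₂ k 0 ^ 2 + freq L₁ L₂ k 1 ^ 2 : ℝ) : ℂ) * b k) =
      Complex.I * (freq L₁ L₂ k 0 : ℂ) * (Complex.I * (freq L₁ L₂ k 0 : ℂ) * b k) +
      Complex.I * (freq L₁ L₂ k 1 : ℂ) * (Complex.I * (freq L₁ L₂ k 1 : ℂ) * b k) := fun k => by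
    push_cast
    linear_combination (-((freq L₁ L₂ k 0 : ℂ) ^ 2 + (freq L₁ L₂ k 1 : ℂ) ^ 2) * b k) *
      Complex.I_sq
  simp only [e]
  rw [fourierSeries_apply ((hj 0).add (hj 1))]
  congr 2; ext k; ring

/-- Termwise differentiation in time. -/
theorem hasDerivAt_fourierSeries {b b' : ℝ → ℤ × ℤ → ℂ} {l r t : ℝ} {B B' : ℤ × ℤ → ℝ}
    (hB : Summable B) (hB' : Summable B') (hb : ∀ k, ∀ s ∈ Set.Ioo l r, ‖b s k‖ ≤ B k)
    (hb' : ∀ k, ∀ s ∈ Set.Ioo l r, ‖b' s k‖ ≤ B' k)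
    (hd : ∀ k, ∀ s ∈ Set.Ioo l r, HasDerivAt (fun s => b s k) (b' s k) s)
    (ht : t ∈ Set.Ioo l r) (z : Torus L₁ L₂) :
    HasDerivAt (fun s => fourierSeries L₁ L₂ (b s) z) (fourierSeries L₁ L₂ (b' t) z) t := by
  have hs : ∀ s ∈ Set.Ioo l r, Summable (b s) := fun s hs =>
    .of_norm_bounded hB fun k => hb k s hs
  have h := hasDerivAt_tsum_of_isPreconnected (g := fun k s => b s k * expo k z)
    (g' := fun k s => b' s k * expo k z) hB' isOpen_Ioo isPreconnected_Ioo
    (fun k s hs => (hd k s hs).mul_const _) (fun k s hs => by simpa using hb' k s hs) ht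
    (summable_mul_expo (hs t ht) z) ht
  rw [fourierSeries_apply (.of_norm_bounded hB' fun k => hb' k t ht)]
  refine h.congr_of_eventuallyEq ?_
  filter_upwards [Ioo_mem_nhds ht.1 ht.2] with s hs'
  exact fourierSeries_apply (hs s hs') z

end Differentiation

/-! ### The mild solution as a classical solution. -/

section Classical

variable {L₁ L₂ : ℝ} [Fact (0 < L₁)] [Fact (0 < L₂)]

theorem lift_fieldOf (a : Fin 2 → ℤ × ℤ → ℂ) :
    lift (fieldOf L₁ L₂ a) =
      fun p => ∑ j, reSingle j (fourierSeries L₁ L₂ (a j) (toTorus L₁ L₂ p)) := by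
  ext1 p; exact fieldOf_apply a _

theorem lift_fieldOf_apply (a : Fin 2 → ℤ × ℤ → ℂ) (p : Plane) (j : Fin 2) :
    lift (fieldOf L₁ L₂ a) p j = (fourierSeries L₁ L₂ (a j) (toTorus L₁ L₂ p)).re :=
  fieldOf_apply_apply a _ j

theorem contDiff_lift_fieldOf {a : Fin 2 → ℤ × ℤ → ℂ} {n : ℕ}
    (ha : ∀ j, Summable fun k => bracket L₁ L₂ k ^ n * ‖a j k‖) :
    ContDiff ℝ n (lift (fieldOf L₁ L₂ a)) := by
  rw [lift_fieldOf]
  exact ContDiff.sum fun j _ => (reSingle j).contDiff.comp (contDiff_fourierSeries (ha j))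

theorem iteratedFDeriv_lift_fieldOf {a : Fin 2 → ℤ × ℤ → ℂ} {i n : ℕ} (hi : i ≤ n)
    (ha : ∀ j, Summable fun k => bracket L₁ L₂ k ^ n * ‖a j k‖) (p : Plane) :
    iteratedFDeriv ℝ i (lift (fieldOf L₁ L₂ a)) p =
      ∑ j, (reSingle j).compContinuousMultilinearMap (iteratedFDeriv ℝ i
        (fun p => fourierSeries L₁ L₂ (a j) (toTorus L₁ L₂ p)) p) := by
  have hc : ∀ j, ContDiff ℝ i fun p => fourierSeries L₁ L₂ (a j) (toTorus L₁ L₂ p) := fun j =>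
    (contDiff_fourierSeries (ha j)).of_le (by exact_mod_cast hi)
  rw [lift_fieldOf]
  refine (congrFun (iteratedFDeriv_sum fun j _ => (reSingle j).contDiff.comp (hc j)) p).trans ?_
  rw [Finset.sum_apply]
  refine Finset.sum_congr rfl fun j _ => ?_
  exact (reSingle j).iteratedFDeriv_comp_left (hc j).contDiffAt le_rfl

theorem continuousOn_iteratedFDeriv_lift_fieldOf {a : ℝ → Fin 2 → ℤ × ℤ → ℂ} {s : Set ℝ}
    {B : ℤ × ℤ → ℝ} {i n : ℕ} (hi : i ≤ n) (hc : ∀ j k, ContinuousOn (fun t => a t j k) s)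
    (hB : Summable fun k => bracket L₁ L₂ k ^ n * B k) (ha : ∀ j k, ∀ t ∈ s, ‖a t j k‖ ≤ B k) :
    ContinuousOn (fun q : ℝ × Plane => iteratedFDeriv ℝ i (lift (fieldOf L₁ L₂ (a q.1))) q.2)
      (s ×ˢ Set.univ) := by
  have hs : ∀ t ∈ s, ∀ j, Summable fun k => bracket L₁ L₂ k ^ n * ‖a t j k‖ := fun t ht j =>
    .of_nonneg_of_le (fun k => mul_nonneg (pow_nonneg (bracket_pos k).le _) (norm_nonneg _))
      (fun k => mul_le_mul_of_nonneg_left (ha j k t ht) (pow_nonneg (bracket_pos k).le _)) hB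
  refine ContinuousOn.congr ?_ fun q hq => iteratedFDeriv_lift_fieldOf hi (hs q.1 hq.1) q.2
  refine continuousOn_finsetSum _ fun j _ => ?_
  exact (ContinuousLinearMap.compContinuousMultilinearMapL ℝ (fun _ : Fin i => Plane) ℂ Plane
    (reSingle j)).continuous.comp_continuousOn
      (continuousOn_iteratedFDeriv_fourierSeries hi (hc j) hB (ha j))

theorem fourierSeries_neg (b : ℤ × ℤ → ℂ) :
    fourierSeries L₁ L₂ (fun k => -b k) = -fourierSeries L₁ L₂ b := by
  rw [fourierSeries, fourierSeries, ← tsum_neg]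
  simp only [neg_smul]

variable {u₀ : L2Field L₁ L₂} {T : ℝ} {u : ℝ → L2Field L₁ L₂}

/-- The time derivative of the coefficients of a mild solution. -/
def rateCoeff (f : L2Field L₁ L₂) (j : Fin 2) (k : ℤ × ℤ) : ℂ :=
  -(symb L₁ L₂ k : ℂ) * fieldCoeff f j k - Complex.I * (freq L₁ L₂ k j : ℂ) * quad f k

/-- A time derivative costs four powers, through the symbol; the single power lost to the gradient
is absorbed in these. -/
theorem norm_rateCoeff_le {f : L2Field L₁ L₂} {C M : ℝ} {n : ℕ}
    {j : Fin 2} {k : ℤ × ℤ} (hC : ‖fieldCoeff f j k‖ ≤ C * (bracket L₁ L₂ k ^ (n + 4))⁻¹)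
    (hM : ‖quad f k‖ ≤ M * (bracket L₁ L₂ k ^ (n + 4))⁻¹) :
    ‖rateCoeff f j k‖ ≤ (C + M) * (bracket L₁ L₂ k ^ n)⁻¹ := by
  have hr := bracket_pos (L₁ := L₁) (L₂ := L₂) k
  have hr1 := one_le_bracket (L₁ := L₁) (L₂ := L₂) k
  rw [rateCoeff]
  refine (norm_sub_le _ _).trans ?_
  rw [norm_mul, norm_neg, norm_mul, norm_mul, Complex.norm_I, one_mul, Complex.norm_real,
    Complex.norm_real, Real.norm_eq_abs, Real.norm_eq_abs]
  have h1 := mul_le_mul (abs_symb_le k) hC (norm_nonneg _) (by positivity)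
  have h2 := mul_le_mul ((abs_freq_le k j).trans (le_self_pow₀ hr1 (by norm_num : 4 ≠ 0))) hM
    (norm_nonneg _) (by positivity)
  refine (add_le_add h1 h2).trans_eq ?_
  rw [pow_add]
  field_simp

theorem summable_bracket_mul_bound (C : ℝ) {m n : ℕ} (h : m + 3 ≤ n) :
    Summable fun k => bracket L₁ L₂ k ^ m * (C * (bracket L₁ L₂ k ^ n)⁻¹) := by
  obtain ⟨d, rfl⟩ := Nat.exists_eq_add_of_le (show m ≤ n by omega)
  refine ((summable_bracket_pow (L₁ := L₁) (L₂ := L₂) (show 3 ≤ d by omega)).mul_left C).congr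
    fun k => ?_
  have hr := bracket_pos (L₁ := L₁) (L₂ := L₂) k
  rw [pow_add]
  field_simp

/-- The equation in physical space follows from the equation for the coefficients. -/
theorem equation_of_summable {f : L2Field L₁ L₂}
    (ha : ∀ j, Summable fun k => bracket L₁ L₂ k ^ 4 * ‖fieldCoeff f j k‖)
    (hq : Summable fun k => bracket L₁ L₂ k ^ 1 * ‖quad f k‖) (p : Plane) (j : Fin 2) :
    lift (fieldOf L₁ L₂ (rateCoeff f)) p j
      + (lift (fieldOf L₁ L₂ (fieldCoeff f)) p 0 *
          pderiv j (fun q => lift (fieldOf L₁ L₂ (fieldCoeff f)) q 0) p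
        + lift (fieldOf L₁ L₂ (fieldCoeff f)) p 1 *
          pderiv j (fun q => lift (fieldOf L₁ L₂ (fieldCoeff f)) q 1) p)
    = - Laplacian.laplacian (Laplacian.laplacian
          (fun q => lift (fieldOf L₁ L₂ (fieldCoeff f)) q j)) p
      - Laplacian.laplacian (fun q => lift (fieldOf L₁ L₂ (fieldCoeff f)) q j) p := by
  set a := fieldCoeff f with ha'
  have hs : ∀ j, Summable (a j) := fun j => summable_of_bracket (ha j)
  have hsy : ∀ j, IsHermitianSeq (a j) := isHermitianSeq_fieldCoeff f
  have hlow : ∀ m ≤ 4, ∀ j, Summable fun k => bracket L₁ L₂ k ^ m * ‖a j k‖ := fun m hm j => by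
    refine .of_nonneg_of_le
      (fun k => mul_nonneg (pow_nonneg (bracket_pos k).le _) (norm_nonneg _)) (fun k => ?_) (ha j)
    gcongr
    exact one_le_bracket k
  -- the nonlinearity
  have hqc : quad f = fun k => (conv (a 0) (a 0) k + conv (a 1) (a 1) k) / 2 := by
    ext k
    conv_lhs => rw [eq_fieldLp hs hsy (f := f) fun _ _ => rfl]
    exact quad_fieldLp hs hsy k
  have hsq := summable_of_bracket hq
  have hq2 : (fun p => (fourierSeries L₁ L₂ (quad f) (toTorus L₁ L₂ p)).re) = fun p =>
      ((fourierSeries L₁ L₂ (a 0) (toTorus L₁ L₂ p)).re ^ 2 +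
        (fourierSeries L₁ L₂ (a 1) (toTorus L₁ L₂ p)).re ^ 2) / 2 := by
    ext p
    set z := toTorus L₁ L₂ p
    have h0 := summable_conv (hs 0) (hs 0)
    have h1 := summable_conv (hs 1) (hs 1)
    have : fourierSeries L₁ L₂ (quad f) z =
        (((fourierSeries L₁ L₂ (a 0) z).re ^ 2 + (fourierSeries L₁ L₂ (a 1) z).re ^ 2) / 2 : ℝ) := by
      push_cast
      rw [ofReal_re_fourierSeries (hs 0) (hsy 0), ofReal_re_fourierSeries (hs 1) (hsy 1), sq, sq,
        fourierSeries_mul (hs 0) (hs 0), fourierSeries_mul (hs 1) (hs 1), fourierSeries_apply hsq,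
        fourierSeries_apply h0, fourierSeries_apply h1,
        ← (summable_mul_expo h0 z).tsum_add (summable_mul_expo h1 z), ← tsum_div_const, hqc]
      congr 1; ext l; ring
    rw [this, Complex.ofReal_re]
  have hcd : ∀ i, DifferentiableAt ℝ
      (fun p => (fourierSeries L₁ L₂ (a i) (toTorus L₁ L₂ p)).re) p := fun i =>
    ((Complex.reCLM.contDiff.comp (contDiff_fourierSeries (hlow 1 (by norm_num) i))).differentiable
      (by norm_num)) p
  -- The nonlinearity is `∂_j(|u|²/2)`: the series of `quad f` is differentiated termwise on one
  -- side and by the chain rule on the other.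
  have hnl : (fourierSeries L₁ L₂ (a 0) (toTorus L₁ L₂ p)).re *
        pderiv j (fun p => (fourierSeries L₁ L₂ (a 0) (toTorus L₁ L₂ p)).re) p +
      (fourierSeries L₁ L₂ (a 1) (toTorus L₁ L₂ p)).re *
        pderiv j (fun p => (fourierSeries L₁ L₂ (a 1) (toTorus L₁ L₂ p)).re) p =
      (fourierSeries L₁ L₂ (fun k => Complex.I * (freq L₁ L₂ k j : ℂ) * quad f k)
        (toTorus L₁ L₂ p)).re := by
    have h := congrFun (pderiv_fourierSeries hq j) p
    rw [hq2] at h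
    rw [← h]
    have hd := (((hcd 0).hasFDerivAt.pow 2).add ((hcd 1).hasFDerivAt.pow 2)).mul_const (1 / 2 : ℝ)
    have hd' : HasFDerivAt (fun p => ((fourierSeries L₁ L₂ (a 0) (toTorus L₁ L₂ p)).re ^ 2 +
        (fourierSeries L₁ L₂ (a 1) (toTorus L₁ L₂ p)).re ^ 2) / 2) _ p :=
      hd.congr_of_eventuallyEq (.of_forall fun p => by simp; ring)
    simp only [pderiv]
    rw [hd'.fderiv]
    simp
    ring
  -- the linear part
  set lam : ℤ × ℤ → ℂ := fun k => -((freq L₁ L₂ k 0 ^ 2 + freq L₁ L₂ k 1 ^ 2 : ℝ) : ℂ) with hlam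
  have hlam_norm : ∀ k, ‖lam k‖ ≤ bracket L₁ L₂ k ^ 2 := fun k => by
    rw [hlam, norm_neg, Complex.norm_real, Real.norm_of_nonneg (by positivity), bracket_sq]
    linarith
  have hla : ∀ j, Summable fun k => bracket L₁ L₂ k ^ 2 * ‖lam k * a j k‖ := fun j => by
    refine .of_nonneg_of_le
      (fun k => mul_nonneg (pow_nonneg (bracket_pos k).le _) (norm_nonneg _)) (fun k => ?_) (ha j)
    have hr := bracket_pos (L₁ := L₁) (L₂ := L₂) k
    rw [norm_mul]
    calc _ ≤ bracket L₁ L₂ k ^ 2 * (bracket L₁ L₂ k ^ 2 * ‖a j k‖) := by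
          gcongr; exact hlam_norm k
      _ = _ := by ring
  have hlla : ∀ j, Summable fun k => lam k * (lam k * a j k) := fun j => by
    refine .of_norm_bounded (hla j) fun k => ?_
    rw [norm_mul]
    gcongr; exact hlam_norm k
  have hL1 : Laplacian.laplacian (fun p => (fourierSeries L₁ L₂ (a j) (toTorus L₁ L₂ p)).re) =
      fun p => (fourierSeries L₁ L₂ (fun k => lam k * a j k) (toTorus L₁ L₂ p)).re :=
    laplacian_fourierSeries (hlow 2 (by norm_num) j)
  have hL2 : Laplacian.laplacian
      (fun p => (fourierSeries L₁ L₂ (fun k => lam k * a j k) (toTorus L₁ L₂ p)).re) =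
      fun p => (fourierSeries L₁ L₂ (fun k => lam k * (lam k * a j k)) (toTorus L₁ L₂ p)).re :=
    laplacian_fourierSeries (hla j)
  -- With `lam = -|κ|²` the symbol of the Laplacian, `σ = lam² + lam`.
  have hrate : rateCoeff f j = fun k => (-(lam k * (lam k * a j k)) - lam k * a j k) -
      Complex.I * (freq L₁ L₂ k j : ℂ) * quad f k := by
    ext k
    rw [rateCoeff, hlam, symb]
    push_cast
    ring
  have hsl : Summable fun k => lam k * a j k := summable_of_bracket (hla j)
  have hsI : Summable fun k => Complex.I * (freq L₁ L₂ k j : ℂ) * quad f k :=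
    summable_of_bracket (n := 0) (summable_freq_mul hq j)
  simp only [lift_fieldOf_apply]
  rw [hnl, hL1, hL2, hrate, fourierSeries_sub ((hlla j).neg.sub hsl) hsI,
    fourierSeries_sub (hlla j).neg hsl, fourierSeries_neg]
  simp

theorem IsMildSolution.isClassicalSolution (hu : IsMildSolution u₀ (Set.Icc 0 T) u) :
    IsClassicalSolution 0 T fun t => fieldOf L₁ L₂ (fieldCoeff (u t)) := by
  have key : ∀ ε, 0 < ε → ∃ C M, 0 ≤ C ∧ 0 ≤ M ∧
      (∀ t ∈ Set.Icc ε T, ∀ j k,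
        ‖fieldCoeff (u t) j k‖ ≤ C * (bracket L₁ L₂ k ^ (5 + 4))⁻¹) ∧
      ∀ t ∈ Set.Icc ε T, ∀ k, ‖quad (u t) k‖ ≤ M * (bracket L₁ L₂ k ^ (5 + 4))⁻¹ := fun ε hε => by
    -- Order `3 * 2 + 3 = 9` is the first in the bootstrap that suffices: four space derivatives
    -- need `4 + 3 = 7`, and after the four powers lost to a time derivative the remaining `5` must
    -- be at least `3`.
    obtain ⟨C, hC0, hC⟩ := hu.exists_decay 2 hε
    obtain ⟨M, hM0, hM⟩ := hu.exists_norm_quad_le_of_decay hε hC0 (by norm_num) hC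
    exact ⟨C, M, hC0, hM0, hC, hM⟩
  have mono : ∀ {m : ℕ} {a B : ℤ × ℤ → ℝ}, (∀ k, 0 ≤ a k) → (∀ k, a k ≤ B k) →
      (Summable fun k => bracket L₁ L₂ k ^ m * B k) →
      Summable fun k => bracket L₁ L₂ k ^ m * a k := fun h0 h1 h2 =>
    .of_nonneg_of_le (fun k => mul_nonneg (pow_nonneg (bracket_pos k).le _) (h0 k))
      (fun k => mul_le_mul_of_nonneg_left (h1 k) (pow_nonneg (bracket_pos k).le _)) h2
  have hfs : ∀ t ∈ Set.Ioo 0 T, ∀ j,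
      Summable fun k => bracket L₁ L₂ k ^ 4 * ‖fieldCoeff (u t) j k‖ := fun t ht j => by
    obtain ⟨C, M, -, -, hC, -⟩ := key t ht.1
    exact mono (fun k => norm_nonneg _) (hC t ⟨le_rfl, ht.2.le⟩ j)
      (summable_bracket_mul_bound C (by norm_num))
  have hqs : ∀ t ∈ Set.Ioo 0 T, Summable fun k => bracket L₁ L₂ k ^ 1 * ‖quad (u t) k‖ :=
    fun t ht => by
    obtain ⟨C, M, -, -, -, hM⟩ := key t ht.1
    exact mono (fun k => norm_nonneg _) (hM t ⟨le_rfl, ht.2.le⟩)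
      (summable_bracket_mul_bound M (by norm_num))
  have hsub : ∀ {ε : ℝ}, 0 < ε → Set.Ioo ε T ⊆ Set.Icc 0 T := fun hε s hs =>
    ⟨hε.le.trans hs.1.le, hs.2.le⟩
  have hder : ∀ t ∈ Set.Ioo 0 T, ∀ p : Plane,
      HasDerivAt (fun s => lift (fieldOf L₁ L₂ (fieldCoeff (u s))) p)
        (lift (fieldOf L₁ L₂ (rateCoeff (u t))) p) t := fun t ht p => by
    obtain ⟨C, M, hC0, hM0, hC, hM⟩ := key (t / 2) (half_pos ht.1)
    simp only [lift_fieldOf]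
    refine HasDerivAt.fun_sum fun j _ => ?_
    refine (reSingle j).hasFDerivAt.comp_hasDerivAt t ?_
    refine hasDerivAt_fourierSeries (l := t / 2) (r := T)
      (b := fun s => fieldCoeff (u s) j) (b' := fun s => rateCoeff (u s) j)
      ((summable_bracket_pow (L₁ := L₁) (L₂ := L₂) (show 3 ≤ 5 + 4 by norm_num)).mul_left C)
      ((summable_bracket_pow (L₁ := L₁) (L₂ := L₂) (show 3 ≤ 5 by norm_num)).mul_left (C + M))
      (fun k s hs => hC s (Set.Ioo_subset_Icc_self hs) j k)
      (fun k s hs => norm_rateCoeff_le (hC s (Set.Ioo_subset_Icc_self hs) j k)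
        (hM s (Set.Ioo_subset_Icc_self hs) k))
      (fun k s hs => hu.hasDerivAt_fieldCoeff ⟨(half_pos ht.1).trans hs.1, hs.2⟩ j k)
      ⟨half_lt_self ht.1, ht.2⟩ _
  -- The decay constants degenerate as time tends to zero, so regularity near a time `t` is proved
  -- on the neighbourhood `(t/2, T)`.
  have hloc : ∀ q : ℝ × Plane, q ∈ Set.Ioo 0 T ×ˢ (Set.univ : Set Plane) →
      Set.Ioo (q.1 / 2) T ×ˢ (Set.univ : Set Plane) ∈ nhds q := fun q hq =>
    (isOpen_Ioo.prod isOpen_univ).mem_nhds ⟨⟨half_lt_self hq.1.1, hq.1.2⟩, trivial⟩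
  refine ⟨fun t ht => contDiff_lift_fieldOf (n := 4) (hfs t ht), fun i hi q hq => ?_,
    fun t ht p => (hder t ht p).differentiableAt, ?_, fun t ht p j => ?_⟩
  · have hq0 := half_pos hq.1.1
    have hT : 0 ≤ T := (hq.1.1.trans hq.1.2).le
    obtain ⟨C, M, -, -, hC, -⟩ := key (q.1 / 2) hq0
    have h := continuousOn_iteratedFDeriv_lift_fieldOf (s := Set.Ioo (q.1 / 2) T)
      (a := fun t => fieldCoeff (u t)) (i := i) (n := 4) hi
      (fun j k => (hu.continuousOn_fieldCoeff hT j k).mono (hsub hq0))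
      (summable_bracket_mul_bound C (show 4 + 3 ≤ 5 + 4 by norm_num))
      (fun j k t ht => hC t (Set.Ioo_subset_Icc_self ht) j k)
    exact (h.continuousAt (hloc q hq)).continuousWithinAt
  · refine ContinuousOn.congr (f := fun q : ℝ × Plane =>
      fieldOf L₁ L₂ (rateCoeff (u q.1)) (toTorus L₁ L₂ q.2)) ?_ fun q hq => (hder q.1 hq.1 q.2).deriv
    intro q hq
    have hq0 := half_pos hq.1.1
    have hT : 0 ≤ T := (hq.1.1.trans hq.1.2).le
    obtain ⟨C, M, hC0, hM0, hC, hM⟩ := key (q.1 / 2) hq0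
    have h : ContinuousOn (fun t => fieldOf L₁ L₂ (rateCoeff (u t))) (Set.Ioo (q.1 / 2) T) := by
      refine continuousOn_fieldOf (fun j k => ?_)
        ((summable_bracket_pow (L₁ := L₁) (L₂ := L₂) (show 3 ≤ 5 by norm_num)).mul_left (C + M))
        (fun j k s hs => norm_rateCoeff_le (hC s (Set.Ioo_subset_Icc_self hs) j k)
          (hM s (Set.Ioo_subset_Icc_self hs) k))
      exact ((continuousOn_const.mul (hu.continuousOn_fieldCoeff hT j k)).sub
        (continuousOn_const.mul (continuousOn_quad hu.continuousOn k))).mono (hsub hq0)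
    have h2 : ContinuousOn (fun q : ℝ × Plane =>
        fieldOf L₁ L₂ (rateCoeff (u q.1)) (toTorus L₁ L₂ q.2))
        (Set.Ioo (q.1 / 2) T ×ˢ Set.univ) :=
      (continuous_eval (F := C(Torus L₁ L₂, Plane))).comp_continuousOn
        ((h.comp continuousOn_fst fun q hq => hq.1).prodMk
        (continuous_toTorus.comp continuous_snd).continuousOn)
    exact (h2.continuousAt (hloc q hq)).continuousWithinAt
  · have h1 : HasDerivAt (fun s => lift (fieldOf L₁ L₂ (fieldCoeff (u s))) p j)
        (lift (fieldOf L₁ L₂ (rateCoeff (u t))) p j) t :=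
      (EuclideanSpace.proj (𝕜 := ℝ) j : Plane →L[ℝ] ℝ).hasFDerivAt.comp_hasDerivAt t (hder t ht p)
    rw [h1.deriv]
    exact equation_of_summable (hfs t ht) (hqs t ht) p j

theorem IsMildSolution.curl_eq (hu : IsMildSolution u₀ (Set.Icc 0 T) u) (h₀ : IsCurlFree u₀)
    {t : ℝ} (ht : t ∈ Set.Ioo 0 T) (p : Plane) :
    pderiv 1 (fun q => lift (fieldOf L₁ L₂ (fieldCoeff (u t))) q 0) p =
      pderiv 0 (fun q => lift (fieldOf L₁ L₂ (fieldCoeff (u t))) q 1) p := by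
  obtain ⟨C, hC0, hC⟩ := hu.exists_decay 2 ht.1
  have hs : ∀ j, Summable fun k => bracket L₁ L₂ k ^ 1 * ‖fieldCoeff (u t) j k‖ := fun j =>
    .of_nonneg_of_le (fun k => mul_nonneg (pow_nonneg (bracket_pos k).le _) (norm_nonneg _))
      (fun k => mul_le_mul_of_nonneg_left (hC t ⟨le_rfl, ht.2.le⟩ j k)
        (pow_nonneg (bracket_pos k).le _))
      (summable_bracket_mul_bound C (by norm_num))
  have h : (fun k => Complex.I * (freq L₁ L₂ k 1 : ℂ) * fieldCoeff (u t) 0 k) =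
      fun k => Complex.I * (freq L₁ L₂ k 0 : ℂ) * fieldCoeff (u t) 1 k :=
    funext (hu.curlFree h₀ (Set.Ioo_subset_Icc_self ht))
  simp only [lift_fieldOf_apply]
  rw [pderiv_fourierSeries (hs 0), pderiv_fourierSeries (hs 1), h]

end Classical

end

end KS2D


theorem proposition6p3 (L₁ L₂ : ℝ) [Fact (0 < L₁)] [Fact (0 < L₂)]
    (u₀ : KS2D.L2Field L₁ L₂) (T : ℝ) (hT : 0 < T)
    (J : Set ℝ) (hJ : J = Set.Ico 0 T ∨ J = Set.Icc 0 T)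
    (u : ℝ → KS2D.L2Field L₁ L₂) (hu : KS2D.IsMildSolution u₀ J u)
    (hlim : Filter.limsup (fun t => ‖u t‖ₑ) (nhdsWithin T (Set.Iio T)) < ⊤) :
    ∃ T' : ℝ, T < T' ∧ ∃ u' : ℝ → KS2D.L2Field L₁ L₂,
      KS2D.IsMildSolution u₀ (Set.Icc 0 T') u' ∧ Set.EqOn u' u J ∧
      ∃ w : ℝ → KS2D.Torus L₁ L₂ → KS2D.Plane,
        (∀ t ∈ Set.Ioo 0 T', ⇑(u' t) =ᵐ[MeasureTheory.volume] w t) ∧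
        KS2D.IsClassicalSolution 0 T' w ∧
        (KS2D.IsCurlFree u₀ → ∀ t ∈ Set.Ioo 0 T', ∀ p : KS2D.Plane,
          KS2D.pderiv 1 (fun q => KS2D.lift (w t) q 0) p =
            KS2D.pderiv 0 (fun q => KS2D.lift (w t) q 1) p) := by
  obtain ⟨T', hT', u', hu', hE⟩ := KS2D.exists_extension hT hJ hu hlim
  -- The classical representative is the sum of the Fourier series of `u'`.
  refine ⟨T', hT', u', hu', hE, fun t => KS2D.fieldOf L₁ L₂ (KS2D.fieldCoeff (u' t)),
    fun t ht => ?_, hu'.isClassicalSolution, fun h₀ t ht p => hu'.curl_eq h₀ ht p⟩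
  conv_lhs => rw [hu'.eq_fieldLp ⟨ht.1, ht.2.le⟩]
  exact KS2D.coeFn_fieldLp _
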